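/- \textbf{Setting.} Let $\mathcal A$ be a nonempty finite action set, $\mathcal Y$ a Euclidean space or a compact subset of one, $\nu$ a measure on $\mathcal Y$, and for each $a\in\mathcal A$ let $Q^*(\cdot|a)$ be a probability measure with positive density $q^*(\cdot|a)$ with respect to $\nu$ (the true distribution of the outcome after action $a$). Let $u:\mathcal A\times\mathcal Y\to\mathbb R$ satisfy $u(a,\cdot)\in L^1(Q^*(\cdot|a))$, let $\delta\in[0,1)$ be a discount factor and $\alpha>1$ a switching threshold. Let $\Theta$ be the class of models $\theta=(\Omega^\theta,q^\theta)$, where $\Omega^\theta$ is a nonempty finite subset of a Euclidean space and, for all $a\in\mathcal A$ and $\omega\in\Omega^\theta$, $q^\theta(\cdot|a,\omega)$ is a positive probability density with respect to $\nu$ under which $u(a,\cdot)$ is integrable and for which there is $g\in L^2(\nu)$ with $|\ln (q^*(\cdot|a)/q^\theta(\cdot|a,\omega))|\le g$ $Q^*(\cdot|a)$-a.s. For a belief $\pi\in\Delta\Omega^\theta$ let $B^\theta(a,y,\pi)$ be the Bayesian posterior after $(a,y)$. Let $U^\theta$ be the bounded solution of $$U^\theta(\pi)=\max_{a\in\mathcal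 A}\sum_{\omega\in\Omega^\theta}\pi(\omega)\int_{\mathcal Y}\big[u(a,y)+\delta U^\theta(B^\theta(a,y,\pi))\big]q^\theta(y|a,\omega)\,\nu(dy).$$ A policy $a^\theta:\Delta\Omega^\theta\to\mathcal A$ is optimal if it is measurable and $a^\theta(\pi)$ attains this maximum for every $\pi$; $A_m^\theta(\pi)$ is the set of maximizers when $\delta=0$ (the myopically optimal actions). In periods $t=0,1,\dots$ an agent takes an action $a_t$ and observes $y_t$, drawn from $Q^*(\cdot|a_t)$ independently over time. Given a prior $\pi_0^\theta$, let $\pi_t^\theta$ be the posterior given $(a_\tau,y_\tau)_{\tau<t}$ and $$l_t^\theta=\sum_{\omega\in\Omega^\theta}\pi_0^\theta(\omega)\prod_{\tau<t}q^\theta(y_\tau|a_\tau,\omega).$$ A \emph{dogmatic modeler} with model $\theta$, prior $\pi_0^\theta$ and policy $a^\theta$ plays $a_t=a^\theta(\pi_t^\theta)$ in every period. A \emph{switcher} with initial model $\theta$ and competing model $\theta^c$ (each with a prior and a policy) sets $m_0=\theta$. At each $t\ge1$ she sets $m_t$ to the model other than $m_{t-1}$ if that model's likelihood divided by $l_t^{m_{t-1}}$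 exceeds $\alpha$, and sets $m_t=m_{t-1}$ otherwise. She plays $a_t=a^{m_t}(\pi_t^{m_t})$. Model $\theta$ \emph{persists against} $\theta^c$ at given priors and policies if, with positive probability, $m_t=\theta$ for all sufficiently large $t$. For $\sigma\in\Delta\mathcal A$ let $\Omega^\theta(\sigma)$ be the set of minimizers over $\omega\in\Omega^\theta$ of $\sum_a\sigma(a)D_{KL}(q^*(\cdot|a)\,\|\,q^\theta(\cdot|a,\omega))$. Strategy $\sigma$ is a \emph{self-confirming equilibrium} (SCE) under $\theta$ if there is a belief $\pi$ with $\operatorname{supp}\pi\subseteq\Omega^\theta(\sigma)$ such that $\operatorname{supp}\sigma\subseteq A_m^\theta(\pi)$ and $q^*(\cdot|a)=q^\theta(\cdot|a,\omega)$ $\nu$-a.e. for all $\omega\in\operatorname{supp}\pi$ and $a\in\operatorname{supp}\sigma$. It is \emph{p-absorbing} if, for some full-support prior and some optimal policy, there is $T\ge 0$ such that with positive probability the dogmatic modeler with model $\theta$ plays only actions in $\operatorname{supp}\sigma$ in all periods $t\ge T$. \textbf{Theorem.} Let $\theta\in\Theta$ and let $\Sigma^*$ be the set of all p-absorbing SCEs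 under $\theta$. Suppose that, at a full-support prior $\pi_0^\theta$ and an optimal policy $a^\theta$, model $\theta$ persists against every $\theta^c\in\Theta$ at every full-support prior $\pi_0^{\theta^c}$ and every optimal policy $a^{\theta^c}$. Then $$\pi_0^\theta\Big(\bigcup_{\sigma\in\Sigma^*}\Omega^\theta(\sigma)\Big)\ \ge\ \frac1\alpha .$$ -/

import Mathlib

open MeasureTheory Set
open scoped ENNReal

noncomputable section

namespace SwitcherModel

/-- The objective environment. The density `qStar a` of the true distribution `Q*(· | a)` is
taken with respect to the common measure `ν` on the outcome space. -/
structure Environment (A Y : Type*) [MeasurableSpace Y] where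
  /-- common dominating measure -/
  ν : Measure Y
  /-- true outcome densities -/
  qStar : A → Y → ℝ
  /-- payoff function -/
  u : A → Y → ℝ
  /-- discount factor -/
  δ : ℝ
  qStar_measurable : ∀ a, Measurable (qStar a)
  qStar_pos : ∀ a y, 0 < qStar a y
  qStar_lintegral : ∀ a, ∫⁻ y, ENNReal.ofReal (qStar a y) ∂ν = 1
  u_integrable : ∀ a, Integrable (u a) (ν.withDensity fun y => ENNReal.ofReal (qStar a y))
  δ_nonneg : 0 ≤ δ
  δ_lt_one : δ < 1

variable {A Y : Type*} [MeasurableSpace Y]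

/-- The true outcome distribution `Q*(· | a)`. -/
def Environment.QStar (E : Environment A Y) (a : A) : Measure Y :=
  E.ν.withDensity fun y => ENNReal.ofReal (E.qStar a y)

instance (E : Environment A Y) (a : A) : IsProbabilityMeasure (E.QStar a) :=
  ⟨by rw [Environment.QStar, withDensity_apply _ MeasurableSet.univ, Measure.restrict_univ]
      exact E.qStar_lintegral a⟩

/-- A subjective model: a nonempty finite parameter set in a Euclidean space and, for every
action and parameter, a positive outcome density, subject to the standing regularity
assumptions. The type `Model E` is the class `Θ` of all admissible models. -/
structure Model (E : Environment A Y) where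
  /-- dimension of the Euclidean space that contains the parameter set -/
  dim : ℕ
  /-- the parameter set -/
  params : Finset (EuclideanSpace ℝ (Fin dim))
  params_nonempty : params.Nonempty
  /-- the outcome densities predicted by the model -/
  q : A → params → Y → ℝ
  q_measurable : ∀ a ω, Measurable (q a ω)
  q_pos : ∀ a ω y, 0 < q a ω y
  q_lintegral : ∀ a ω, ∫⁻ y, ENNReal.ofReal (q a ω y) ∂E.ν = 1
  u_integrable : ∀ a ω,
    Integrable (E.u a) (E.ν.withDensity fun y => ENNReal.ofReal (q a ω y))
  log_ratio_bound : ∀ a ω, ∃ g : Y → ℝ, MemLp g 2 E.ν ∧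
    ∀ᵐ y ∂(E.QStar a), |Real.log (E.qStar a y / q a ω y)| ≤ g y

variable {E : Environment A Y}

namespace Model

/-- The predicted outcome distribution `Q^θ(· | a, ω)`. -/
def Q (θ : Model E) (a : A) (ω : θ.params) : Measure Y :=
  E.ν.withDensity fun y => ENNReal.ofReal (θ.q a ω y)

/-- Beliefs: probability vectors over the parameter set. -/
abbrev Belief (θ : Model E) : Type := stdSimplex ℝ θ.params

/-- The belief puts positive weight on every parameter. -/
def FullSupport (θ : Model E) (π : θ.Belief) : Prop := ∀ ω, 0 < π.1 ω

/-- Density of the next outcome predicted under belief `π` and action `a`. -/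
def predictive (θ : Model E) (a : A) (y : Y) (π : θ.Belief) : ℝ :=
  ∑ ω, π.1 ω * θ.q a ω y

theorem predictive_pos (θ : Model E) (a : A) (y : Y) (π : θ.Belief) :
    0 < θ.predictive a y π := by
  have hnn : ∀ ω ∈ Finset.univ, 0 ≤ π.1 ω * θ.q a ω y := fun ω _ =>
    mul_nonneg (π.2.1 ω) (θ.q_pos a ω y).le
  refine lt_of_le_of_ne (Finset.sum_nonneg hnn) fun h => ?_
  have h0 := (Finset.sum_eq_zero_iff_of_nonneg hnn).1 h.symm
  have h1 : ∑ ω, π.1 ω = 0 := Finset.sum_eq_zero fun ω hω =>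
    (mul_eq_zero.1 (h0 ω hω)).resolve_right (θ.q_pos a ω y).ne'
  rw [π.2.2] at h1
  exact one_ne_zero h1

/-- Bayesian operator `B^θ(a, y, π)`. -/
def bayes (θ : Model E) (a : A) (y : Y) (π : θ.Belief) : θ.Belief :=
  ⟨fun ω => π.1 ω * θ.q a ω y / θ.predictive a y π,
    fun ω => div_nonneg (mul_nonneg (π.2.1 ω) (θ.q_pos a ω y).le) (θ.predictive_pos a y π).le,
    by
      rw [← Finset.sum_div]
      exact div_self (θ.predictive_pos a y π).ne'⟩

/-- Expected discounted payoff of action `a` at belief `π` with continuation values `U`: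
the maximand of the dynamic programming problem. -/
def actionValue (θ : Model E) (δ : ℝ) (U : θ.Belief → ℝ) (π : θ.Belief) (a : A) : ℝ :=
  ∑ ω, π.1 ω * ∫ y, (E.u a y + δ * U (θ.bayes a y π)) * θ.q a ω y ∂E.ν

/-- `U` is the value function of the dynamic programming problem with discount factor `δ`:
the (unique) bounded measurable solution of the Bellman equation. -/
structure IsValueFunction (θ : Model E) (δ : ℝ) (U : θ.Belief → ℝ) : Prop where
  measurable : Measurable U
  bounded : ∃ M, ∀ π, |U π| ≤ M
  bellman : ∀ π, IsGreatest (range (θ.actionValue δ U π)) (U π)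

/-- The correspondence `A^θ` of optimal actions for discount factor `δ`. -/
def optimalActions (θ : Model E) (δ : ℝ) (π : θ.Belief) : Set A :=
  {a | ∃ U, θ.IsValueFunction δ U ∧ θ.actionValue δ U π a = U π}

/-- The correspondence `A_m^θ` of myopically optimal actions. -/
def myopicActions (θ : Model E) (π : θ.Belief) : Set A := θ.optimalActions 0 π

/-- A (measurable) pure policy that selects an optimal action at every belief. -/
structure IsOptimalPolicy (θ : Model E) (pol : θ.Belief → A) : Prop where
  measurable : ∀ a, MeasurableSet (pol ⁻¹' {a})
  optimal : ∀ π, pol π ∈ θ.optimalActions E.δ π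

/-- Likelihood `l_t^θ` of a finite history (most recent observation first). -/
def likelihood (θ : Model E) (π₀ : θ.Belief) (h : List (A × Y)) : ℝ :=
  ∑ ω, π₀.1 ω * (h.map fun p => θ.q p.1 ω p.2).prod

/-- Posterior `π_t^θ` after a finite history (most recent observation first). -/
def posterior (θ : Model E) (π₀ : θ.Belief) : List (A × Y) → θ.Belief
  | [] => π₀
  | p :: h => θ.bayes p.1 p.2 (posterior θ π₀ h)

end Model

section Dynamics

/-- The law of the outcome paths: `y t a` is the outcome obtained when `a` is taken in
period `t`; all these outcomes are independent, and `y t a` has law `Q*(· | a)`. -/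
def outcomeLaw [Fintype A] (E : Environment A Y) : Measure (ℕ → A → Y) :=
  Measure.infinitePi fun _ : ℕ => Measure.pi fun a : A => E.QStar a

/-- The history at the beginning of period `t` (most recent observation first) of an agent who
chooses `act h` after the history `h`, on the outcome path `y`. -/
def history (act : List (A × Y) → A) (y : ℕ → A → Y) : ℕ → List (A × Y)
  | 0 => []
  | t + 1 => (act (history act y t), y t (act (history act y t))) :: history act y t

/-- Behaviour of the dogmatic modeler with model `θ`. -/
def dogmaticAction (θ : Model E) (π₀ : θ.Belief) (pol : θ.Belief → A) (h : List (A × Y)) : A :=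
  pol (θ.posterior π₀ h)

/-- The two models among which the switcher chooses. -/
inductive ModelLabel
  | initial
  | competing

/-- The switcher's model choice `m_t` after a history, by the Bayes factor rule with threshold
`α`. As the Bayes factor of the current model relative to itself is `1 < α`, a switch can only
be triggered by the other model, and is triggered when its Bayes factor exceeds `α`. -/
def modelChoice (θ θc : Model E) (α : ℝ) (π₀ : θ.Belief) (πc : θc.Belief) :
    List (A × Y) → ModelLabel
  | [] => .initial
  | p :: h =>
    open Classical in
    match modelChoice θ θc α π₀ πc h with
    | .initial =>
      if α < θc.likelihood πc (p :: h) / θ.likelihood π₀ (p :: h) then .competing else .initial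
    | .competing =>
      if α < θ.likelihood π₀ (p :: h) / θc.likelihood πc (p :: h) then .initial else .competing

/-- Behaviour of the switcher: she follows the policy of the currently adopted model, at the
posterior of that model given the full history. -/
def switcherAction (θ θc : Model E) (α : ℝ) (π₀ : θ.Belief) (πc : θc.Belief)
    (pol : θ.Belief → A) (polc : θc.Belief → A) (h : List (A × Y)) : A :=
  match modelChoice θ θc α π₀ πc h with
  | .initial => pol (θ.posterior π₀ h)
  | .competing => polc (θc.posterior πc h)

variable [Fintype A]

/-- The model `θ` persists against `θc` at the given priors and policies: with positive
probability the switcher who starts with `θ` eventually adopts `θ` forever. -/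
def PersistsAgainst (θ θc : Model E) (α : ℝ) (π₀ : θ.Belief) (πc : θc.Belief)
    (pol : θ.Belief → A) (polc : θc.Belief → A) : Prop :=
  0 < outcomeLaw E {y | ∃ T, ∀ t, T ≤ t →
    modelChoice θ θc α π₀ πc (history (switcherAction θ θc α π₀ πc pol polc) y t)
      = ModelLabel.initial}

end Dynamics

namespace Model

variable [Fintype A]

/-- The Kullback-Leibler minimizers `Ω^θ(σ)`. -/
def klMinimizers (θ : Model E) (σ : stdSimplex ℝ A) : Set θ.params :=
  {ω | ∀ ω', ∑ a, ENNReal.ofReal (σ.1 a) * InformationTheory.klDiv (E.QStar a) (θ.Q a ω)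
    ≤ ∑ a, ENNReal.ofReal (σ.1 a) * InformationTheory.klDiv (E.QStar a) (θ.Q a ω')}

/-- `σ` is a Berk-Nash equilibrium under `θ`. -/
def IsBerkNash (θ : Model E) (σ : stdSimplex ℝ A) : Prop :=
  ∃ π : θ.Belief, (∀ ω, π.1 ω ≠ 0 → ω ∈ θ.klMinimizers σ) ∧
    ∀ a, σ.1 a ≠ 0 → a ∈ θ.myopicActions π

/-- `σ` is a self-confirming equilibrium under `θ`. -/
def IsSelfConfirming (θ : Model E) (σ : stdSimplex ℝ A) : Prop :=
  ∃ π : θ.Belief, (∀ ω, π.1 ω ≠ 0 → ω ∈ θ.klMinimizers σ) ∧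
    (∀ a, σ.1 a ≠ 0 → a ∈ θ.myopicActions π) ∧
    ∀ ω, π.1 ω ≠ 0 → ∀ a, σ.1 a ≠ 0 → E.qStar a =ᵐ[E.ν] θ.q a ω

/-- `σ` is absorbing with positive probability: for some full-support prior and optimal policy,
the dogmatic modeler with positive probability plays only actions in the support of `σ` from
some fixed period on. -/
def IsPAbsorbing (θ : Model E) (σ : stdSimplex ℝ A) : Prop :=
  θ.IsBerkNash σ ∧ ∃ π₀ : θ.Belief, θ.FullSupport π₀ ∧
    ∃ pol : θ.Belief → A, θ.IsOptimalPolicy pol ∧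
      ∃ T : ℕ, 0 < outcomeLaw E {y | ∀ t, T ≤ t →
        σ.1 (dogmaticAction θ π₀ pol (history (dogmaticAction θ π₀ pol) y t)) ≠ 0}

/-- The set `Σ*` of p-absorbing self-confirming equilibria under `θ`. -/
def pAbsorbingSCE (θ : Model E) : Set (stdSimplex ℝ A) :=
  {σ | θ.IsSelfConfirming σ ∧ θ.IsPAbsorbing σ}

/-- The probability `π(S)` that a belief assigns to a set of parameters. -/
def mass (θ : Model E) (π : θ.Belief) (S : Set θ.params) : ℝ := ∑ ω, S.indicator π.1 ω

end Model

end SwitcherModel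

end

/-! Let `C` be the union of the KL minimizers over p-absorbing SCEs and suppose its prior mass is
below `1 / α`. The prior on `C` can then be scaled by some `κ > α` with mass to spare. The
competitor `θc` has the parameters of `θ` together with the true density. Its prior is `κ` times the
old one on `C`, plus a weight `η > 0` on every parameter and on the truth
(`exists_reweighted_competitor`). Divided by the likelihood of the truth, its likelihood is at least
`κ ∑_C π₀ ω * R ω + η`, where `R ω` is the likelihood ratio of `ω` to the truth. While the switcher
keeps holding `θ`, this is at most `α ∑ π₀ ω * R ω`.

Each `R ω` is a nonnegative martingale under the true law, so it converges almost surely to some `L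
ω`. A Hellinger argument gives `L ω = 0` whenever `ω` mispredicts an action played infinitely often
(`ae_tendsto_weight_zero_of_frequently`). The bound passes to the limit, and `η` forces `∑ π₀ ω * L
ω > 0`, so the posterior converges to a belief whose support predicts every recurrent action
correctly. By continuity of the value function each recurrent action is optimal at that limit. There
it conveys no information, so it is also myopically optimal, and the recurrent actions support an
SCE.

This SCE is p-absorbing. There are countably many pairs of a settling time and an action set, so
almost every path that settles lies in a settling event of positive probability. Fixing the outcomes
before the settling time turns the remaining play into that of a dogmatic modeler
(`exists_dogmatic_of_settledPaths`). Hence `L` vanishes off `C`, both sums agree, and `κ S + η ≤ α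
S` with `S > 0` contradicts `κ > α`. -/

noncomputable section

namespace SwitcherModel

open Filter Topology ProbabilityTheory

/-! ### Multiplicative weights along histories -/

section Histories

variable {A Y : Type*}

/-- Product of the one-period weights along a history. -/
def weight (r : A → Y → ℝ) (h : List (A × Y)) : ℝ := (h.map fun p => r p.1 p.2).prod

@[simp]
theorem weight_nil (r : A → Y → ℝ) : weight r [] = 1 := rfl

@[simp]
theorem weight_cons (r : A → Y → ℝ) (p : A × Y) (h : List (A × Y)) :
    weight r (p :: h) = r p.1 p.2 * weight r h := by simp [weight]

theorem weight_pos {r : A → Y → ℝ} (hr : ∀ a y, 0 < r a y) (h : List (A × Y)) :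
    0 < weight r h := by
  induction h with
  | nil => simp
  | cons p h ih => simpa using mul_pos (hr _ _) ih

theorem weight_nonneg {r : A → Y → ℝ} (hr : ∀ a y, 0 ≤ r a y) (h : List (A × Y)) :
    0 ≤ weight r h := by
  induction h with
  | nil => simp
  | cons p h ih => simpa using mul_nonneg (hr _ _) ih

theorem weight_mul (r s : A → Y → ℝ) (h : List (A × Y)) :
    weight (fun a y => r a y * s a y) h = weight r h * weight s h := by
  simp [weight, List.prod_map_mul]

theorem history_congr {act : List (A × Y) → A} {y z : ℕ → A → Y} {t : ℕ}
    (h : ∀ s < t, y s = z s) : history act y t = history act z t := by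
  induction t with
  | zero => rfl
  | succ t ih =>
    have ih := ih fun s hs => h s (hs.trans t.lt_succ_self)
    simp only [history]
    rw [ih, h t t.lt_succ_self]

/-- Splitting over the action separates a factor determined by the past from a fresh outcome `y t a`
with `a` fixed, so that independence can be used despite the endogenous action. -/
theorem weight_history_succ [Fintype A] (r : A → Y → ℝ) (act : List (A × Y) → A) (t : ℕ)
    (y : ℕ → A → Y) :
    weight r (history act y (t + 1)) =
      ∑ a, {y | act (history act y t) = a}.indicator (fun y => weight r (history act y t)) y *
        r a (y t a) := by
  rw [Finset.sum_eq_single (act (history act y t))]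
  · rw [indicator_of_mem (by simp), history, weight_cons, mul_comm]
  · intro b _ hb
    rw [indicator_of_notMem (by simpa using hb.symm), zero_mul]
  · simp

end Histories

variable {A Y : Type*} [MeasurableSpace Y] {E : Environment A Y}

/-! ### Integrals against densities -/

theorem integrable_of_lintegral_ofReal_eq_one {μ : Measure Y} {f : Y → ℝ} (hf : Measurable f)
    (h0 : ∀ y, 0 ≤ f y) (h1 : ∫⁻ y, ENNReal.ofReal (f y) ∂μ = 1) : Integrable f μ :=
  (lintegral_ofReal_ne_top_iff_integrable hf.aestronglyMeasurable (ae_of_all _ h0)).1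
    (by rw [h1]; exact ENNReal.one_ne_top)

theorem integral_of_lintegral_ofReal_eq_one {μ : Measure Y} {f : Y → ℝ} (hf : Measurable f)
    (h0 : ∀ y, 0 ≤ f y) (h1 : ∫⁻ y, ENNReal.ofReal (f y) ∂μ = 1) : ∫ y, f y ∂μ = 1 := by
  rw [integral_eq_lintegral_of_nonneg_ae (ae_of_all _ h0) hf.aestronglyMeasurable, h1]
  rfl

theorem integrable_withDensity_ofReal_iff {μ : Measure Y} {f : Y → ℝ} (hf : Measurable f)
    (h0 : ∀ y, 0 ≤ f y) {g : Y → ℝ} :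
    Integrable g (μ.withDensity fun y => ENNReal.ofReal (f y)) ↔
      Integrable (fun y => g y * f y) μ := by
  rw [integrable_withDensity_iff_integrable_smul' hf.ennreal_ofReal
    (ae_of_all _ fun _ => ENNReal.ofReal_lt_top)]
  simp only [ENNReal.toReal_ofReal (h0 _), smul_eq_mul, mul_comm]

theorem integral_withDensity_ofReal {μ : Measure Y} {f : Y → ℝ} (hf : Measurable f)
    (h0 : ∀ y, 0 ≤ f y) (g : Y → ℝ) :
    ∫ y, g y ∂(μ.withDensity fun y => ENNReal.ofReal (f y)) = ∫ y, g y * f y ∂μ := by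
  rw [integral_withDensity_eq_integral_toReal_smul hf.ennreal_ofReal
    (ae_of_all _ fun _ => ENNReal.ofReal_lt_top)]
  simp only [ENNReal.toReal_ofReal (h0 _), smul_eq_mul, mul_comm]

/-! ### Bellman equation: payoffs, continuation values, uniqueness -/

namespace Model

variable (θ : Model E)

theorem integrable_q (a : A) (ω : θ.params) : Integrable (θ.q a ω) E.ν :=
  integrable_of_lintegral_ofReal_eq_one (θ.q_measurable a ω) (fun y => (θ.q_pos a ω y).le)
    (θ.q_lintegral a ω)

theorem integral_q (a : A) (ω : θ.params) : ∫ y, θ.q a ω y ∂E.ν = 1 :=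
  integral_of_lintegral_ofReal_eq_one (θ.q_measurable a ω) (fun y => (θ.q_pos a ω y).le)
    (θ.q_lintegral a ω)

theorem integrable_u_mul_q (a : A) (ω : θ.params) :
    Integrable (fun y => E.u a y * θ.q a ω y) E.ν :=
  (integrable_withDensity_ofReal_iff (θ.q_measurable a ω) fun y => (θ.q_pos a ω y).le).1
    (θ.u_integrable a ω)

theorem continuous_belief_apply (ω : θ.params) : Continuous fun π : θ.Belief => π.1 ω :=
  (continuous_apply ω).comp continuous_subtype_val

theorem measurable_bayes (a : A) (π : θ.Belief) : Measurable fun y => θ.bayes a y π := by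
  refine Measurable.subtype_mk (measurable_pi_lambda _ fun ω => ?_)
  have := θ.q_measurable
  unfold predictive
  fun_prop

theorem continuous_bayes (a : A) (y : Y) : Continuous fun π : θ.Belief => θ.bayes a y π := by
  refine Continuous.subtype_mk (continuous_pi fun ω => ?_) _
  refine Continuous.div ?_ ?_ fun π => (θ.predictive_pos a y π).ne'
  · exact (θ.continuous_belief_apply ω).mul continuous_const
  · exact continuous_finsetSum _ fun ω _ => (θ.continuous_belief_apply ω).mul continuous_const

/-- Expected one-period payoff of an action at a belief. -/
def flowPayoff (π : θ.Belief) (a : A) : ℝ := ∑ ω, π.1 ω * ∫ y, E.u a y * θ.q a ω y ∂E.ν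

/-- Expected value of `U` at the next posterior. -/
def continuation (U : θ.Belief → ℝ) (π : θ.Belief) (a : A) : ℝ :=
  ∑ ω, π.1 ω * ∫ y, U (θ.bayes a y π) * θ.q a ω y ∂E.ν

variable {θ}

theorem integrable_continuation {U : θ.Belief → ℝ} (hU : Measurable U)
    (hb : ∃ M, ∀ π, |U π| ≤ M) (a : A) (π : θ.Belief) (ω : θ.params) :
    Integrable (fun y => U (θ.bayes a y π) * θ.q a ω y) E.ν := by
  obtain ⟨M, hM⟩ := hb
  exact (θ.integrable_q a ω).bdd_mul
    (hU.comp (θ.measurable_bayes a π)).aestronglyMeasurable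
    (ae_of_all _ fun y => by simpa using hM (θ.bayes a y π))

theorem actionValue_eq {U : θ.Belief → ℝ} (hU : Measurable U)
    (hb : ∃ M, ∀ π, |U π| ≤ M) (δ : ℝ) (a : A) (π : θ.Belief) :
    θ.actionValue δ U π a = θ.flowPayoff π a + δ * θ.continuation U π a := by
  unfold actionValue flowPayoff continuation
  rw [Finset.mul_sum, ← Finset.sum_add_distrib]
  refine Finset.sum_congr rfl fun ω _ => ?_
  have : (fun y => (E.u a y + δ * U (θ.bayes a y π)) * θ.q a ω y) =
      fun y => E.u a y * θ.q a ω y + δ * (U (θ.bayes a y π) * θ.q a ω y) := by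
    ext y; ring
  rw [this, integral_add (θ.integrable_u_mul_q a ω)
    ((integrable_continuation hU hb a π ω).const_mul δ), integral_const_mul]
  ring

/-- Blackwell's monotonicity and discounting conditions in one inequality: posterior weights and
densities have total mass one, so a constant passes through unchanged. -/
theorem continuation_le_add {U V : θ.Belief → ℝ} (hU : Measurable U)
    (hUb : ∃ M, ∀ π, |U π| ≤ M) (hV : Measurable V) (hVb : ∃ M, ∀ π, |V π| ≤ M) {c : ℝ}
    (h : ∀ π, U π ≤ V π + c) (a : A) (π : θ.Belief) :
    θ.continuation U π a ≤ θ.continuation V π a + c := by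
  have hc : c = ∑ ω, π.1 ω * c := by rw [← Finset.sum_mul, π.2.2, one_mul]
  unfold continuation
  conv_rhs => rw [hc]
  rw [← Finset.sum_add_distrib]
  refine Finset.sum_le_sum fun ω _ => ?_
  rw [← mul_add]
  refine mul_le_mul_of_nonneg_left ?_ (π.2.1 ω)
  have : c = ∫ y, c * θ.q a ω y ∂E.ν := by rw [integral_const_mul, integral_q, mul_one]
  conv_rhs => rw [this]
  rw [← integral_add (integrable_continuation hV hVb a π ω) ((θ.integrable_q a ω).const_mul c)]
  refine integral_mono (integrable_continuation hU hUb a π ω)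
    ((integrable_continuation hV hVb a π ω).add ((θ.integrable_q a ω).const_mul c)) fun y => ?_
  have := mul_le_mul_of_nonneg_right (h (θ.bayes a y π)) (θ.q_pos a ω y).le
  simpa [add_mul] using this

theorem continuous_flowPayoff (a : A) : Continuous fun π : θ.Belief => θ.flowPayoff π a := by
  exact continuous_finsetSum _ fun ω _ => (θ.continuous_belief_apply ω).mul continuous_const

/-- Dominated convergence with bound `M * q`: the belief enters the integrand only through the
continuous Bayes map, and `U` is bounded on the compact simplex. -/
theorem continuous_continuation {U : θ.Belief → ℝ} (hU : Continuous U) (a : A) :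
    Continuous fun π : θ.Belief => θ.continuation U π a := by
  unfold continuation
  obtain ⟨M, hM⟩ := isCompact_univ.exists_bound_of_continuousOn hU.continuousOn
  refine continuous_finsetSum _ fun ω _ => (θ.continuous_belief_apply ω).mul ?_
  refine continuous_of_dominated (bound := fun y => M * θ.q a ω y) ?_ ?_ ?_ ?_
  · exact fun π => (integrable_continuation hU.measurable
      ⟨M, fun π => hM π (mem_univ _)⟩ a π ω).aestronglyMeasurable
  · refine fun π => ae_of_all _ fun y => ?_
    rw [norm_mul, Real.norm_of_nonneg (θ.q_pos a ω y).le]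
    exact mul_le_mul_of_nonneg_right (hM _ (mem_univ _)) (θ.q_pos a ω y).le
  · exact (θ.integrable_q a ω).const_mul M
  · exact ae_of_all _ fun y => (hU.comp (θ.continuous_bayes a y)).mul continuous_const

theorem bounded_of_continuous {U : θ.Belief → ℝ} (hU : Continuous U) : ∃ M, ∀ π, |U π| ≤ M := by
  obtain ⟨M, hM⟩ := isCompact_univ.exists_bound_of_continuousOn hU.continuousOn
  exact ⟨M, fun π => hM π (mem_univ _)⟩

/-- Compare both Bellman equations at an action that is maximal for `U`. -/
theorem IsValueFunction.le_add {δ : ℝ} (hδ : 0 ≤ δ) {U V : θ.Belief → ℝ}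
    (hU : θ.IsValueFunction δ U) (hV : θ.IsValueFunction δ V) {c : ℝ}
    (h : ∀ π, U π ≤ V π + c) (π : θ.Belief) : U π ≤ V π + δ * c := by
  obtain ⟨a, ha⟩ := (hU.bellman π).1
  have h1 := (hV.bellman π).2 ⟨a, rfl⟩
  rw [actionValue_eq hU.measurable hU.bounded] at ha
  rw [actionValue_eq hV.measurable hV.bounded] at h1
  have h2 := mul_le_mul_of_nonneg_left
    (continuation_le_add hU.measurable hU.bounded hV.measurable hV.bounded h a π) hδ
  linarith

/-- Iterating the step gives the gap `δ ^ n * c`, which tends to zero. This replaces a sup-norm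
contraction for functions that are only bounded and measurable. -/
theorem le_of_geometric_improvement {X : Type*} {δ : ℝ} (hδ : 0 ≤ δ) (hδ1 : δ < 1) {U V : X → ℝ}
    (hstep : ∀ c, (∀ x, U x ≤ V x + c) → ∀ x, U x ≤ V x + δ * c) {c : ℝ}
    (hc : ∀ x, U x ≤ V x + c) (x : X) : U x ≤ V x := by
  have h (n : ℕ) : ∀ x, U x ≤ V x + δ ^ n * c := by
    induction n with
    | zero => simpa using hc
    | succ n ih =>
      have := hstep _ ih
      simpa [pow_succ', mul_assoc] using this
  have hl : Filter.Tendsto (fun n : ℕ => V x + δ ^ n * c) Filter.atTop (nhds (V x + 0 * c)) :=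
    ((tendsto_pow_atTop_nhds_zero_of_lt_one hδ hδ1).mul_const c).const_add _
  have := ge_of_tendsto' hl fun n => h n x
  simpa using this

theorem IsValueFunction.le {δ : ℝ} (hδ : 0 ≤ δ) (hδ1 : δ < 1) {U V : θ.Belief → ℝ}
    (hU : θ.IsValueFunction δ U) (hV : θ.IsValueFunction δ V) (π : θ.Belief) : U π ≤ V π := by
  obtain ⟨M, hM⟩ := hU.bounded
  obtain ⟨N, hN⟩ := hV.bounded
  refine le_of_geometric_improvement (c := M + N) hδ hδ1 (fun c h => hU.le_add hδ hV h) ?_ π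
  intro x
  linarith [(abs_le.1 (hM x)).2, (abs_le.1 (hN x)).1]

theorem IsValueFunction.unique {δ : ℝ} (hδ : 0 ≤ δ) (hδ1 : δ < 1) {U V : θ.Belief → ℝ}
    (hU : θ.IsValueFunction δ U) (hV : θ.IsValueFunction δ V) : U = V :=
  funext fun π => le_antisymm (hU.le hδ hδ1 hV π) (hV.le hδ hδ1 hU π)

theorem mem_optimalActions_iff {δ : ℝ} (hδ : 0 ≤ δ) (hδ1 : δ < 1) {U : θ.Belief → ℝ}
    (hU : θ.IsValueFunction δ U) {π : θ.Belief} {a : A} :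
    a ∈ θ.optimalActions δ π ↔ θ.actionValue δ U π a = U π := by
  refine ⟨?_, fun h => ⟨U, hU, h⟩⟩
  rintro ⟨V, hV, h⟩
  rwa [hU.unique hδ hδ1 hV]

/-! ### Existence and continuity of the value function; optimal policies -/

section Existence

variable [Fintype A] [Nonempty A]

variable (θ) in
/-- The Bellman operator on continuous functions. -/
def bellmanOperator (δ : ℝ) (U : C(θ.Belief, ℝ)) : C(θ.Belief, ℝ) where
  toFun π := Finset.univ.sup' Finset.univ_nonempty
    fun a => θ.flowPayoff π a + δ * θ.continuation U π a
  continuous_toFun := Continuous.finset_sup'_apply _ fun a _ =>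
    (continuous_flowPayoff a).add (continuous_const.mul (continuous_continuation U.continuous a))

theorem bellmanOperator_le {δ : ℝ} (hδ : 0 ≤ δ) (U V : C(θ.Belief, ℝ)) (π : θ.Belief) :
    θ.bellmanOperator δ U π ≤ θ.bellmanOperator δ V π + δ * dist U V := by
  refine Finset.sup'_le Finset.univ_nonempty _ fun a _ => ?_
  have h1 : θ.flowPayoff π a + δ * θ.continuation V π a ≤ θ.bellmanOperator δ V π :=
    Finset.le_sup' (fun a => θ.flowPayoff π a + δ * θ.continuation V π a) (Finset.mem_univ a)
  have h2 : θ.continuation U π a ≤ θ.continuation V π a + dist U V := by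
    refine continuation_le_add U.continuous.measurable (bounded_of_continuous U.continuous)
      V.continuous.measurable (bounded_of_continuous V.continuous) (fun x => ?_) a π
    have := ContinuousMap.dist_apply_le_dist (f := U) (g := V) x
    rw [Real.dist_eq] at this
    linarith [(abs_le.1 this).2]
  have h3 := mul_le_mul_of_nonneg_left h2 hδ
  linarith

/-- Banach's fixed point theorem on continuous functions. With uniqueness among bounded measurable
solutions, it makes every value function continuous. -/
theorem exists_continuous_isValueFunction (θ : Model E) {δ : ℝ} (hδ : 0 ≤ δ) (hδ1 : δ < 1) :
    ∃ U : θ.Belief → ℝ, Continuous U ∧ θ.IsValueFunction δ U := by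
  have hc : ContractingWith ⟨δ, hδ⟩ (θ.bellmanOperator δ) := by
    refine ⟨by exact_mod_cast hδ1, LipschitzWith.of_dist_le_mul fun U V => ?_⟩
    change _ ≤ δ * dist U V
    rw [ContinuousMap.dist_le (by positivity)]
    intro π
    rw [Real.dist_eq, abs_le]
    have h1 := bellmanOperator_le hδ U V π
    have h2 := bellmanOperator_le hδ V U π
    rw [dist_comm V U] at h2
    constructor <;> linarith
  set U := ContractingWith.fixedPoint _ hc
  have hU : θ.bellmanOperator δ U = U := hc.fixedPoint_isFixedPt
  refine ⟨U, U.continuous, U.continuous.measurable, bounded_of_continuous U.continuous,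
    fun π => ?_⟩
  have hUπ : U π = Finset.univ.sup' Finset.univ_nonempty
      fun a => θ.flowPayoff π a + δ * θ.continuation U π a := by
    nth_rewrite 1 [← hU]
    rfl
  have hav (a : A) := actionValue_eq U.continuous.measurable
    (bounded_of_continuous U.continuous) δ a π
  constructor
  · obtain ⟨a, -, ha⟩ := Finset.exists_mem_eq_sup' (Finset.univ_nonempty (α := A))
      fun a => θ.flowPayoff π a + δ * θ.continuation U π a
    exact ⟨a, by rw [hav, hUπ, ha]⟩
  · rintro _ ⟨a, rfl⟩
    rw [hav, hUπ]
    exact Finset.le_sup' (fun a => θ.flowPayoff π a + δ * θ.continuation U π a)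
      (Finset.mem_univ a)

theorem IsValueFunction.continuous {δ : ℝ} (hδ : 0 ≤ δ) (hδ1 : δ < 1) {U : θ.Belief → ℝ}
    (hU : θ.IsValueFunction δ U) : Continuous U := by
  obtain ⟨V, hVc, hV⟩ := exists_continuous_isValueFunction θ hδ hδ1
  rwa [hU.unique hδ hδ1 hV]

theorem IsValueFunction.continuous_actionValue {δ : ℝ} (hδ : 0 ≤ δ) (hδ1 : δ < 1)
    {U : θ.Belief → ℝ} (hU : θ.IsValueFunction δ U) (a : A) :
    Continuous fun π => θ.actionValue δ U π a := by
  simp only [actionValue_eq hU.measurable hU.bounded]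
  exact (continuous_flowPayoff a).add
    (continuous_const.mul (continuous_continuation (hU.continuous hδ hδ1) a))

theorem isClosed_setOf_mem_optimalActions (θ : Model E) {δ : ℝ} (hδ : 0 ≤ δ) (hδ1 : δ < 1)
    (a : A) : IsClosed {π | a ∈ θ.optimalActions δ π} := by
  obtain ⟨U, hUc, hU⟩ := exists_continuous_isValueFunction θ hδ hδ1
  simp only [mem_optimalActions_iff hδ hδ1 hU]
  exact isClosed_eq (hU.continuous_actionValue hδ hδ1 a) hUc

/-- Choose the optimal action of least index; each level set is then a finite Boolean combination of
closed sets. -/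
theorem exists_isOptimalPolicy (θ : Model E) : ∃ pol : θ.Belief → A, θ.IsOptimalPolicy pol := by
  have hδ := E.δ_nonneg
  have hδ1 := E.δ_lt_one
  obtain ⟨U, hUc, hU⟩ := exists_continuous_isValueFunction θ hδ hδ1
  classical
  let e := Fintype.equivFin A
  have h (π : θ.Belief) : ∃ a, a ∈ θ.optimalActions E.δ π ∧
      ∀ b, e b < e a → b ∉ θ.optimalActions E.δ π := by
    obtain ⟨a, ha⟩ := (hU.bellman π).1
    have hne : (Finset.univ.filter fun i => e.symm i ∈ θ.optimalActions E.δ π).Nonempty :=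
      ⟨e a, by simpa using ⟨U, hU, ha⟩⟩
    refine ⟨e.symm (Finset.min' _ hne), (Finset.mem_filter.1 (Finset.min'_mem _ hne)).2, ?_⟩
    intro b hb hb'
    rw [Equiv.apply_symm_apply] at hb
    exact (Finset.min'_le _ (e b) (by simpa using hb')).not_gt hb
  choose pol hpol hmin using h
  refine ⟨pol, fun a => ?_, hpol⟩
  have hset : pol ⁻¹' {a} = {π | a ∈ θ.optimalActions E.δ π} ∩
      ⋂ b ∈ {b | e b < e a}, {π | b ∈ θ.optimalActions E.δ π}ᶜ := by
    ext π
    simp only [mem_preimage, mem_singleton_iff, mem_inter_iff, mem_ofPred_eq, mem_iInter,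
      mem_compl_iff]
    constructor
    · rintro rfl
      exact ⟨hpol π, hmin π⟩
    · rintro ⟨h1, h2⟩
      rcases lt_trichotomy (e (pol π)) (e a) with hlt | heq | hgt
      · exact absurd (hpol π) (h2 _ hlt)
      · exact e.injective heq
      · exact absurd h1 (hmin π _ hgt)
  rw [hset]
  have hm (b : A) := (isClosed_setOf_mem_optimalActions θ hδ hδ1 b).measurableSet
  exact (hm a).inter (MeasurableSet.biInter (to_countable _) fun b _ => (hm b).compl)

end Existence

/-! ### Uninformative optimal actions are myopically optimal -/

/-- Beliefs form a martingale under the agent's own predictive law, and the flow payoff is linear in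
the belief. -/
theorem continuation_flowPayoff (a a' : A) (π : θ.Belief) :
    θ.continuation (fun π => θ.flowPayoff π a') π a = θ.flowPayoff π a' := by
  have hc := continuous_flowPayoff (θ := θ) a'
  unfold continuation
  simp_rw [← integral_const_mul]
  rw [← integral_finsetSum _ fun ω _ => (integrable_continuation hc.measurable
    (bounded_of_continuous hc) a π ω).const_mul _]
  have hpt (y : Y) : ∑ ω, π.1 ω * (θ.flowPayoff (θ.bayes a y π) a' * θ.q a ω y) =
      ∑ ω, π.1 ω * (∫ y, E.u a' y * θ.q a' ω y ∂E.ν) * θ.q a ω y := by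
    have hp := (θ.predictive_pos a y π).ne'
    have h1 : ∑ ω, π.1 ω * (θ.flowPayoff (θ.bayes a y π) a' * θ.q a ω y) =
        θ.flowPayoff (θ.bayes a y π) a' * θ.predictive a y π := by
      rw [predictive, Finset.mul_sum]
      exact Finset.sum_congr rfl fun ω _ => by ring
    rw [h1, flowPayoff, Finset.sum_mul]
    refine Finset.sum_congr rfl fun ω _ => ?_
    simp only [bayes]
    field_simp
  simp_rw [hpt]
  rw [integral_finsetSum _ fun ω _ => (θ.integrable_q a ω).const_mul _]
  simp_rw [integral_const_mul, integral_q, mul_one]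
  rfl

/-- Taking the same action forever is feasible, so the value function dominates its payoff. -/
theorem IsValueFunction.flowPayoff_le {δ : ℝ} (hδ : 0 ≤ δ) (hδ1 : δ < 1) {U : θ.Belief → ℝ}
    (hU : θ.IsValueFunction δ U) (π : θ.Belief) (a : A) :
    θ.flowPayoff π a ≤ (1 - δ) * U π := by
  have h1δ : 0 < 1 - δ := by linarith
  have hc := continuous_flowPayoff (θ := θ) a
  obtain ⟨M, hM⟩ := hU.bounded
  obtain ⟨N, hN⟩ := bounded_of_continuous hc
  refine le_of_geometric_improvement (U := fun π => θ.flowPayoff π a) (V := fun π => (1 - δ) * U π)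
    (c := N + (1 - δ) * M) hδ hδ1 (fun c h x => ?_) (fun x => ?_) π
  · have hm : Measurable fun π => (1 - δ) * U π := hU.measurable.const_mul _
    have hb : ∃ M, ∀ π, |(1 - δ) * U π| ≤ M := ⟨(1 - δ) * M, fun π => by
      rw [abs_mul, abs_of_pos h1δ]
      exact mul_le_mul_of_nonneg_left (hM π) h1δ.le⟩
    have h1 := continuation_le_add hc.measurable ⟨N, hN⟩ hm hb h a x
    rw [continuation_flowPayoff] at h1
    have h2 : θ.continuation (fun π => (1 - δ) * U π) x a = (1 - δ) * θ.continuation U x a := by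
      unfold continuation
      rw [Finset.mul_sum]
      refine Finset.sum_congr rfl fun ω _ => ?_
      simp_rw [mul_assoc]
      rw [integral_const_mul]
      ring
    have h3 := (hU.bellman x).2 ⟨a, rfl⟩
    rw [actionValue_eq hU.measurable hU.bounded] at h3
    rw [h2] at h1
    have h4 := mul_le_mul_of_nonneg_left h3 h1δ.le
    have h5 := mul_le_mul_of_nonneg_left h1 hδ
    linarith
  · have h1 := (abs_le.1 (hN x)).2
    have h2 := mul_le_mul_of_nonneg_left (abs_le.1 (hM x)).1 h1δ.le
    linarith

/-- If the belief is supported on parameters that predict the outcome of `a` identically,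
then `a` is uninformative. -/
theorem bayes_eq_self {a : A} {y : Y} {π : θ.Belief} {c : ℝ}
    (h : ∀ ω, π.1 ω ≠ 0 → θ.q a ω y = c) : θ.bayes a y π = π := by
  have hp : θ.predictive a y π = c := by
    have : θ.predictive a y π = ∑ ω, π.1 ω * c := Finset.sum_congr rfl fun ω _ => by
      by_cases h0 : π.1 ω = 0
      · simp [h0]
      · rw [h ω h0]
    rw [this, ← Finset.sum_mul, π.2.2, one_mul]
  have hc : c ≠ 0 := hp ▸ (θ.predictive_pos a y π).ne'
  refine Subtype.ext (funext fun ω => ?_)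
  simp only [bayes, hp]
  by_cases h0 : π.1 ω = 0
  · simp [h0]
  · rw [h ω h0, mul_div_assoc, div_self hc, mul_one]

theorem mem_myopicActions_of_flowPayoff_le [Fintype A] [Nonempty A] {a : A} {π : θ.Belief}
    (h : ∀ b, θ.flowPayoff π b ≤ θ.flowPayoff π a) : a ∈ θ.myopicActions π := by
  obtain ⟨U, -, hU⟩ := exists_continuous_isValueFunction θ le_rfl zero_lt_one
  refine ⟨U, hU, le_antisymm ((hU.bellman π).2 ⟨a, rfl⟩) ?_⟩
  obtain ⟨b, hb⟩ := (hU.bellman π).1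
  rw [← hb, actionValue_eq hU.measurable hU.bounded, actionValue_eq hU.measurable hU.bounded]
  simpa using h b

/-- An optimal action that is uninformative at the belief is myopically optimal. -/
theorem mem_myopicActions_of_mem_optimalActions [Fintype A] [Nonempty A] {δ : ℝ} (hδ : 0 ≤ δ)
    (hδ1 : δ < 1) {a : A} {π : θ.Belief} (ha : a ∈ θ.optimalActions δ π)
    (hq : ∀ ω, π.1 ω ≠ 0 → E.qStar a =ᵐ[E.ν] θ.q a ω) : a ∈ θ.myopicActions π := by
  obtain ⟨U, hU, hUa⟩ := ha
  refine mem_myopicActions_of_flowPayoff_le fun b => (hU.flowPayoff_le hδ hδ1 π b).trans ?_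
  have hae : ∀ᵐ y ∂E.ν, θ.bayes a y π = π := by
    have : ∀ᵐ y ∂E.ν, ∀ ω, π.1 ω ≠ 0 → E.qStar a y = θ.q a ω y := by
      rw [ae_all_iff]
      intro ω
      by_cases h0 : π.1 ω = 0
      · simp [h0]
      · filter_upwards [hq ω h0] with y hy _ using hy
    filter_upwards [this] with y hy
    exact bayes_eq_self fun ω hω => (hy ω hω).symm
  have hcont : θ.continuation U π a = U π := by
    have hi (ω : θ.params) : ∫ y, U (θ.bayes a y π) * θ.q a ω y ∂E.ν = U π := by
      rw [integral_congr_ae (g := fun y => U π * θ.q a ω y)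
        (by filter_upwards [hae] with y hy; rw [hy]), integral_const_mul, integral_q, mul_one]
    unfold continuation
    simp_rw [hi]
    rw [← Finset.sum_mul, π.2.2, one_mul]
  -- Now `U π` equals the flow payoff of `a` plus `δ * U π`, so that flow payoff is `(1 - δ) * U π`,
  -- the upper bound for every other action.
  rw [actionValue_eq hU.measurable hU.bounded, hcont] at hUa
  linarith

end Model

/-! ### Filtration and adapted play -/

/-- Information generated by the outcomes of the periods before `t`. -/
def outcomeFiltration (A Y : Type*) [MeasurableSpace Y] :
    Filtration ℕ (MeasurableSpace.pi : MeasurableSpace (ℕ → A → Y)) where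
  seq t := ⨆ s ∈ Set.Iio t, MeasurableSpace.comap (fun y : ℕ → A → Y => y s) MeasurableSpace.pi
  mono' _ _ hst := biSup_mono fun _ h => lt_of_lt_of_le h hst
  le' _ := iSup₂_le fun s _ => (measurable_pi_apply s).comap_le

theorem measurable_outcomeFiltration_apply {s t : ℕ} (hst : s < t) :
    Measurable[outcomeFiltration A Y t] fun y : ℕ → A → Y => y s := by
  refine Measurable.mono (comap_measurable fun y : ℕ → A → Y => y s) ?_ le_rfl
  exact le_biSup (fun s => MeasurableSpace.comap (fun y : ℕ → A → Y => y s) MeasurableSpace.pi) hst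

/-- The action plan depends measurably on past outcomes along the histories it generates. -/
def IsAdapted (act : List (A × Y) → A) : Prop :=
  ∀ t a, MeasurableSet[outcomeFiltration A Y t] {y | act (history act y t) = a}

section Measurability

variable [Fintype A]

/-- Measurability of play is assumed only before `t`, so that the lemma can serve inside the
induction which proves that the switcher's play is adapted. -/
theorem measurable_weight_history {r : A → Y → ℝ} (hr : ∀ a, Measurable (r a))
    {act : List (A × Y) → A} (t : ℕ)
    (hact : ∀ s < t, ∀ a, MeasurableSet[outcomeFiltration A Y s] {y | act (history act y s) = a}) :
    Measurable[outcomeFiltration A Y t] fun y => weight r (history act y t) := by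
  induction t with
  | zero => exact measurable_const
  | succ t ih =>
    have ih := ih fun s hs => hact s (hs.trans t.lt_succ_self)
    have hle := (outcomeFiltration A Y).mono t.le_succ
    simp_rw [weight_history_succ]
    refine Finset.measurable_fun_sum _ fun a _ => Measurable.mul ?_ ?_
    · exact (ih.indicator (hact t t.lt_succ_self a)).mono hle le_rfl
    · exact (hr a).comp ((measurable_pi_apply a).comp
        (measurable_outcomeFiltration_apply t.lt_succ_self))

end Measurability

/-! ### Likelihood ratios as martingales under the true law -/

section Martingale

variable [Fintype A]

instance (E : Environment A Y) : IsProbabilityMeasure (outcomeLaw E) := by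
  unfold outcomeLaw; infer_instance

theorem measurePreserving_outcome (E : Environment A Y) (t : ℕ) (a : A) :
    MeasurePreserving (fun y : ℕ → A → Y => y t a) (outcomeLaw E) (E.QStar a) :=
  (measurePreserving_eval (fun a : A => E.QStar a) a).comp
    (measurePreserving_eval_infinitePi (fun _ : ℕ => Measure.pi fun a : A => E.QStar a) t)

theorem indep_outcome_outcomeFiltration (E : Environment A Y) (t : ℕ) :
    Indep (MeasurableSpace.comap (fun y : ℕ → A → Y => y t) MeasurableSpace.pi)
      (outcomeFiltration A Y t) (outcomeLaw E) := by
  have h : iIndepFun (fun (t : ℕ) (y : ℕ → A → Y) => y t) (outcomeLaw E) :=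
    iIndepFun_infinitePi (P := fun _ : ℕ => Measure.pi fun a : A => E.QStar a)
      (X := fun _ y => y) fun _ => measurable_id
  have h2 := indep_iSup_of_disjoint (S := {t}) (T := Set.Iio t)
    (fun s => (measurable_pi_apply s).comap_le) h (by simp)
  rw [iSup_singleton] at h2
  exact h2

theorem integrable_outcome {r : A → Y → ℝ} (hi : ∀ a, Integrable (r a) (E.QStar a)) (t : ℕ)
    (a : A) : Integrable (fun y : ℕ → A → Y => r a (y t a)) (outcomeLaw E) :=
  (measurePreserving_outcome E t a).integrable_comp_of_integrable (hi a)

theorem indepFun_outcome {r : A → Y → ℝ} (hr : ∀ a, Measurable (r a)) {t : ℕ}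
    {f : (ℕ → A → Y) → ℝ} (hf : Measurable[outcomeFiltration A Y t] f) (a : A) :
    IndepFun f (fun y : ℕ → A → Y => r a (y t a)) (outcomeLaw E) := by
  refine indep_of_indep_of_le_left (indep_of_indep_of_le_right
    (indep_outcome_outcomeFiltration E t).symm ?_) hf.comap_le
  exact (((hr a).comp (measurable_pi_apply a)).comp
    (comap_measurable fun y : ℕ → A → Y => y t)).comap_le

variable {r : A → Y → ℝ} {act : List (A × Y) → A}

theorem integrable_weight_history (hr : ∀ a, Measurable (r a))
    (hi : ∀ a, Integrable (r a) (E.QStar a)) (hact : IsAdapted act) (t : ℕ) :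
    Integrable (fun y => weight r (history act y t)) (outcomeLaw E) := by
  induction t with
  | zero => exact integrable_const _
  | succ t ih =>
    simp_rw [weight_history_succ]
    refine integrable_finsetSum _ fun a _ => ?_
    exact (indepFun_outcome hr ((measurable_weight_history hr t fun s _ => hact s).indicator
      (hact t a)) a).integrable_mul
        (ih.indicator ((outcomeFiltration A Y).le t _ (hact t a))) (integrable_outcome hi t a)

theorem condExp_outcome (hr : ∀ a, Measurable (r a)) (t : ℕ) (a : A) :
    (outcomeLaw E)[fun y : ℕ → A → Y => r a (y t a) | outcomeFiltration A Y t] =ᵐ[outcomeLaw E]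
      fun _ => ∫ y, r a y ∂(E.QStar a) := by
  have hm : Measurable[MeasurableSpace.comap (fun y : ℕ → A → Y => y t) MeasurableSpace.pi]
      fun y : ℕ → A → Y => r a (y t a) :=
    ((hr a).comp (measurable_pi_apply a : Measurable fun x : A → Y => x a)).comp
      (comap_measurable fun y : ℕ → A → Y => y t)
  have h := condExp_indep_eq (measurable_pi_apply t).comap_le ((outcomeFiltration A Y).le t)
    hm.stronglyMeasurable (indep_outcome_outcomeFiltration E t)
  have hint : ∫ y, r a (y t a) ∂(outcomeLaw E) = ∫ y, r a y ∂(E.QStar a) := by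
    rw [← (measurePreserving_outcome E t a).map_eq]
    exact (integral_map (measurePreserving_outcome E t a).measurable.aemeasurable
      (hr a).aestronglyMeasurable).symm
  rwa [hint] at h

/-- Given the past, only the chosen action's factor survives, and its fresh outcome contributes mean
one. -/
theorem martingale_weight_history (hr : ∀ a, Measurable (r a))
    (hi : ∀ a, Integrable (r a) (E.QStar a)) (h1 : ∀ a, ∫ y, r a y ∂(E.QStar a) = 1)
    (hact : IsAdapted act) :
    Martingale (fun t y => weight r (history act y t)) (outcomeFiltration A Y) (outcomeLaw E) := by
  have hmeas (t : ℕ) := measurable_weight_history hr (act := act) t fun s _ => hact s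
  refine martingale_nat (fun t => (hmeas t).stronglyMeasurable)
    (integrable_weight_history hr hi hact) fun t => ?_
  have hfun : (fun y => weight r (history act y (t + 1))) =
      ∑ a, ({y | act (history act y t) = a}.indicator fun y => weight r (history act y t)) *
        fun y : ℕ → A → Y => r a (y t a) := by
    ext y
    simp [weight_history_succ]
  have hind (a : A) := (hmeas t).indicator (hact t a)
  have hprod (a : A) :
      Integrable (({y | act (history act y t) = a}.indicator
        fun y => weight r (history act y t)) * fun y : ℕ → A → Y => r a (y t a)) (outcomeLaw E) :=
    (indepFun_outcome hr (hind a) a).integrable_mul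
      ((integrable_weight_history hr hi hact t).indicator
        ((outcomeFiltration A Y).le t _ (hact t a))) (integrable_outcome hi t a)
  rw [hfun]
  have hpull (a : A) := (condExp_mul_of_stronglyMeasurable_left (hind a).stronglyMeasurable
    (hprod a) (integrable_outcome hi t a)).trans
      ((condExp_outcome (E := E) hr t a).mono fun y hy => by
        rw [Pi.mul_apply, hy, h1 a, mul_one])
  filter_upwards [condExp_finsetSum (s := Finset.univ) (fun a _ => hprod a)
    (outcomeFiltration A Y t), ae_all_iff.2 hpull] with y hy hy'
  rw [hy, Finset.sum_apply, Finset.sum_congr rfl fun a _ => hy' a,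
    Finset.sum_eq_single (act (history act y t))]
  · rw [indicator_of_mem (by simp)]
  · intro b _ hb
    rw [indicator_of_notMem (by simpa using hb.symm)]
  · simp

/-- A nonnegative martingale has constant `L¹` norm, here one, so Doob's convergence theorem
applies. -/
theorem ae_exists_tendsto_weight_history (hr : ∀ a, Measurable (r a)) (h0 : ∀ a y, 0 ≤ r a y)
    (hi : ∀ a, Integrable (r a) (E.QStar a)) (h1 : ∀ a, ∫ y, r a y ∂(E.QStar a) = 1)
    (hact : IsAdapted act) :
    ∀ᵐ y ∂(outcomeLaw E), ∃ c, Tendsto (fun t => weight r (history act y t)) atTop (𝓝 c) := by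
  have hM := martingale_weight_history hr hi h1 hact
  refine hM.submartingale.exists_ae_tendsto_of_bdd (R := 1) fun t => ?_
  have hint : ∫ y, weight r (history act y t) ∂(outcomeLaw E) = 1 := by
    have := hM.setIntegral_eq (Nat.zero_le t) (s := univ) MeasurableSet.univ
    simp only [setIntegral_univ] at this
    rw [← this]
    simp [history]
  rw [eLpNorm_one_eq_lintegral_enorm]
  have : ∫⁻ y, ‖weight r (history act y t)‖ₑ ∂(outcomeLaw E) = 1 := by
    rw [← ofReal_integral_norm_eq_lintegral_enorm (hM.integrable t)]
    simp only [Real.norm_of_nonneg (weight_nonneg h0 _), hint, ENNReal.ofReal_one]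
  rw [this]
  simp

end Martingale

/-! ### Hellinger affinity and vanishing likelihood ratios -/

section Hellinger

variable {μ : Measure Y} [IsProbabilityMeasure μ] {f : Y → ℝ}

theorem integrable_sqrt (hf : Measurable f) (h0 : ∀ y, 0 < f y) (hi : Integrable f μ) :
    Integrable (fun y => √(f y)) μ := by
  refine ((integrable_const (1 : ℝ)).add hi).mono' hf.sqrt.aestronglyMeasurable
    (ae_of_all _ fun y => ?_)
  rw [Real.norm_of_nonneg (Real.sqrt_nonneg _), Pi.add_apply]
  nlinarith [Real.sq_sqrt (h0 y).le, sq_nonneg (√(f y) - 1), Real.sqrt_nonneg (f y)]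

theorem integral_sqrt_pos (hf : Measurable f) (h0 : ∀ y, 0 < f y) (hi : Integrable f μ) :
    0 < ∫ y, √(f y) ∂μ := by
  rw [integral_pos_iff_support_of_nonneg (fun y => Real.sqrt_nonneg _)
    (integrable_sqrt hf h0 hi)]
  have : Function.support (fun y => √(f y)) = univ := by
    ext y
    simpa using (Real.sqrt_pos.2 (h0 y)).ne'
  rw [this, measure_univ]
  exact one_pos

/-- Expanding the square shows that the affinity `∫ √f` is at most one, with equality only if `f =
1` almost everywhere. -/
theorem integral_sq_sqrt_sub_one (hf : Measurable f) (h0 : ∀ y, 0 < f y) (hi : Integrable f μ)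
    (h1 : ∫ y, f y ∂μ = 1) :
    Integrable (fun y => (√(f y) - 1) ^ 2) μ ∧
      ∫ y, (√(f y) - 1) ^ 2 ∂μ = 2 - 2 * ∫ y, √(f y) ∂μ := by
  have hs := integrable_sqrt hf h0 hi
  have hfun : (fun y => (√(f y) - 1) ^ 2) = fun y => (f y + 1) - 2 * √(f y) := by
    ext y
    nlinarith [Real.sq_sqrt (h0 y).le]
  rw [hfun]
  refine ⟨(hi.add (integrable_const 1)).sub (hs.const_mul 2), ?_⟩
  have hi1 : Integrable (fun y => f y + 1) μ := hi.add (integrable_const 1)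
  rw [integral_sub hi1 (hs.const_mul 2), integral_add hi (integrable_const 1), h1, integral_const_mul]
  simp
  norm_num

theorem integral_sqrt_le_one (hf : Measurable f) (h0 : ∀ y, 0 < f y) (hi : Integrable f μ)
    (h1 : ∫ y, f y ∂μ = 1) : ∫ y, √(f y) ∂μ ≤ 1 := by
  have h := (integral_sq_sqrt_sub_one hf h0 hi h1).2
  have : 0 ≤ ∫ y, (√(f y) - 1) ^ 2 ∂μ := integral_nonneg fun y => sq_nonneg _
  linarith

theorem integral_sqrt_lt_one (hf : Measurable f) (h0 : ∀ y, 0 < f y) (hi : Integrable f μ)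
    (h1 : ∫ y, f y ∂μ = 1) (hne : ¬ f =ᵐ[μ] fun _ => 1) : ∫ y, √(f y) ∂μ < 1 := by
  refine (integral_sqrt_le_one hf h0 hi h1).lt_of_ne fun heq => hne ?_
  obtain ⟨hint, h⟩ := integral_sq_sqrt_sub_one hf h0 hi h1
  rw [heq, mul_one, sub_self, integral_eq_zero_iff_of_nonneg (fun y => sq_nonneg _) hint] at h
  filter_upwards [h] with y hy
  have : √(f y) = 1 := by
    have := pow_eq_zero_iff two_ne_zero |>.1 hy
    linarith
  rwa [Real.sqrt_eq_one] at this

variable [Fintype A] {r : A → Y → ℝ} {act : List (A × Y) → A}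

/-- If `r a` is not degenerate, then the likelihood ratio vanishes on the event that `a` is
played infinitely often. -/
theorem ae_tendsto_weight_zero_of_frequently (hr : ∀ a, Measurable (r a))
    (h0 : ∀ a y, 0 < r a y) (hi : ∀ a, Integrable (r a) (E.QStar a))
    (h1 : ∀ a, ∫ y, r a y ∂(E.QStar a) = 1) (hact : IsAdapted act) {a : A}
    (hne : ¬ r a =ᵐ[E.QStar a] fun _ => 1) :
    ∀ᵐ y ∂(outcomeLaw E), (∃ᶠ t in atTop, act (history act y t) = a) →
      Tendsto (fun t => weight r (history act y t)) atTop (𝓝 0) := by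
  set ρ : A → ℝ := fun b => ∫ y, √(r b y) ∂(E.QStar b)
  have hρ0 (b : A) : 0 < ρ b := integral_sqrt_pos (hr b) (h0 b) (hi b)
  have hρ1 (b : A) : ρ b ≤ 1 := integral_sqrt_le_one (hr b) (h0 b) (hi b) (h1 b)
  have hρa : ρ a < 1 := integral_sqrt_lt_one (hr a) (h0 a) (hi a) (h1 a) hne
  -- Dividing by the affinity gives the square root mean one, so its product along the history is
  -- again a convergent martingale; the removed affinities are collected in `W`.
  set s : A → Y → ℝ := fun b y => √(r b y) / ρ b
  have hconv : ∀ᵐ y ∂(outcomeLaw E),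
      ∃ c, Tendsto (fun t => weight s (history act y t)) atTop (𝓝 c) := by
    refine ae_exists_tendsto_weight_history (fun b => ((hr b).sqrt).div_const _)
      (fun b y => div_nonneg (Real.sqrt_nonneg _) (hρ0 b).le)
      (fun b => (integrable_sqrt (hr b) (h0 b) (hi b)).div_const _) (fun b => ?_) hact
    rw [integral_div]
    exact div_self (hρ0 b).ne'
  filter_upwards [hconv] with y ⟨c, hc⟩ hfreq
  set W : ℕ → ℝ := fun t => weight (fun b (_ : Y) => ρ b) (history act y t)
  have hW0 (t : ℕ) : 0 ≤ W t := weight_nonneg (fun b _ => (hρ0 b).le) _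
  have hWs (t : ℕ) : W (t + 1) = ρ (act (history act y t)) * W t := by
    simp [W, history]
  have hanti : Antitone W := antitone_nat_of_succ_le fun t => by
    rw [hWs]
    exact mul_le_of_le_one_left (hW0 t) (hρ1 _)
  have hWlim := tendsto_atTop_ciInf hanti ⟨0, by rintro _ ⟨t, rfl⟩; exact hW0 t⟩
  set d := ⨅ t, W t
  have hd : d = 0 := by
    have hdiff : Tendsto (fun t => W (t + 1) - ρ a * W t) atTop (𝓝 (d - ρ a * d)) :=
      ((tendsto_add_atTop_iff_nat 1).2 hWlim).sub (hWlim.const_mul _)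
    have hmem : d - ρ a * d ∈ ({0} : Set ℝ) :=
      -- Each play of `a` makes this difference exactly zero, so its limit `(1 - ρ a) * d` is zero.
      isClosed_singleton.mem_of_frequently_of_tendsto (hfreq.mono fun t ht => by
        rw [hWs, ht, sub_self]; rfl) hdiff
    have : (1 - ρ a) * d = 0 := by
      have := mem_singleton_iff.1 hmem
      linarith
    exact (mul_eq_zero.1 this).resolve_left (by linarith)
  have hfac (t : ℕ) : weight r (history act y t) =
      (weight s (history act y t) * W t) * (weight s (history act y t) * W t) := by
    simp only [W]
    rw [← weight_mul, ← weight_mul]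
    congr 1
    ext b x
    simp only [s]
    rw [div_mul_cancel₀ _ (hρ0 b).ne', Real.mul_self_sqrt (h0 b x).le]
  simp_rw [hfac]
  have := (hc.mul hWlim).mul (hc.mul hWlim)
  simpa [hd] using this

end Hellinger

/-! ### Splicing paths, and posteriors as new priors -/

section Splice

/-- The path that follows `w` before period `T` and `z` from period `T` on. -/
def splice (T : ℕ) (w z : ℕ → A → Y) : ℕ → A → Y := fun t => if t < T then w t else z (t - T)

theorem measurable_splice (T : ℕ) :
    Measurable fun p : (ℕ → A → Y) × (ℕ → A → Y) => splice T p.1 p.2 := by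
  refine measurable_pi_lambda _ fun t => ?_
  unfold splice
  split_ifs
  · exact (measurable_pi_apply t).comp measurable_fst
  · exact (measurable_pi_apply (t - T)).comp measurable_snd

theorem measurePreserving_splice [Fintype A] (E : Environment A Y) (T : ℕ) :
    MeasurePreserving (fun p : (ℕ → A → Y) × (ℕ → A → Y) => splice T p.1 p.2)
      ((outcomeLaw E).prod (outcomeLaw E)) (outcomeLaw E) := by
  refine ⟨measurable_splice T, ?_⟩
  refine Measure.eq_infinitePi _ fun s B hB => ?_
  rw [Measure.map_apply (measurable_splice T) (MeasurableSet.pi s.countable_toSet fun i _ => hB i)]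
  set s₁ := s.filter (· < T)
  set s₂ := s.filter (¬ · < T)
  have hinj : Set.InjOn (· - T) (s₂ : Set ℕ) := by
    intro i hi j hj hij
    simp [s₂] at hi hj
    simp only at hij
    omega
  -- A cylinder pulls back to a rectangle of two cylinders, the later coordinates being shifted by
  -- `T`; product measures are determined on cylinders.
  have hpre : (fun p : (ℕ → A → Y) × (ℕ → A → Y) => splice T p.1 p.2) ⁻¹' (Set.pi s B) =
      Set.pi s₁ B ×ˢ Set.pi (s₂.image (· - T) : Finset ℕ) fun i => B (i + T) := by
    ext ⟨w, z⟩
    simp only [mem_preimage, Set.mem_pi, mem_prod, Finset.mem_coe, Finset.forall_mem_image,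
      s₁, s₂, Finset.mem_filter, and_imp, splice]
    constructor
    · intro h
      refine ⟨fun i hi hT => by simpa [hT] using h i hi, fun i hi hT => ?_⟩
      rw [Nat.sub_add_cancel (not_lt.1 hT)]
      simpa [hT] using h i hi
    · rintro ⟨h1, h2⟩ i hi
      by_cases hT : i < T
      · simpa [hT] using h1 i hi hT
      · have := h2 hi hT
        rw [Nat.sub_add_cancel (not_lt.1 hT)] at this
        simpa [hT] using this
  rw [hpre, Measure.prod_prod, outcomeLaw, Measure.infinitePi_pi _ fun i _ => hB i,
    Measure.infinitePi_pi _ fun i _ => hB (i + T), Finset.prod_image hinj]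
  rw [← Finset.prod_filter_mul_prod_filter_not s (· < T)]
  congr 1
  refine Finset.prod_congr rfl fun i hi => ?_
  rw [Nat.sub_add_cancel (not_lt.1 (Finset.mem_filter.1 hi).2)]

namespace Model

variable (θ : Model E)

theorem posterior_append (π₀ : θ.Belief) (h' h : List (A × Y)) :
    θ.posterior π₀ (h' ++ h) = θ.posterior (θ.posterior π₀ h) h' := by
  induction h' with
  | nil => rfl
  | cons p h' ih => simp [posterior, ih]

theorem likelihood_eq (π₀ : θ.Belief) (h : List (A × Y)) :
    θ.likelihood π₀ h = ∑ ω, π₀.1 ω * weight (fun a y => θ.q a ω y) h := rfl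

theorem likelihood_pos (π₀ : θ.Belief) (h : List (A × Y)) : 0 < θ.likelihood π₀ h := by
  rw [likelihood_eq]
  have hnn (ω : θ.params) : 0 ≤ π₀.1 ω * weight (fun a y => θ.q a ω y) h :=
    mul_nonneg (π₀.2.1 ω) (weight_pos (fun a y => θ.q_pos a ω y) h).le
  have hex : ∃ ω, 0 < π₀.1 ω := by
    by_contra! hcon
    have : ∑ ω, π₀.1 ω ≤ 0 := Finset.sum_nonpos fun ω _ => hcon ω
    rw [π₀.2.2] at this
    exact absurd this (by norm_num)
  obtain ⟨ω, hω⟩ := hex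
  exact Finset.sum_pos' (fun ω _ => hnn ω)
    ⟨ω, Finset.mem_univ _, mul_pos hω (weight_pos (fun a y => θ.q_pos a ω y) h)⟩

theorem posterior_apply (π₀ : θ.Belief) (h : List (A × Y)) (ω : θ.params) :
    (θ.posterior π₀ h).1 ω = π₀.1 ω * weight (fun a y => θ.q a ω y) h / θ.likelihood π₀ h := by
  induction h generalizing ω with
  | nil => rw [likelihood_eq]; simp only [weight_nil, mul_one, π₀.2.2, posterior, div_one]
  | cons p h ih =>
    have hl := (θ.likelihood_pos π₀ h).ne'
    have hl' := (θ.likelihood_pos π₀ (p :: h)).ne'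
    have hp : θ.predictive p.1 p.2 (θ.posterior π₀ h) =
        θ.likelihood π₀ (p :: h) / θ.likelihood π₀ h := by
      rw [predictive, likelihood_eq θ π₀ (p :: h), Finset.sum_div]
      refine Finset.sum_congr rfl fun ω _ => ?_
      rw [ih, weight_cons]
      ring
    simp only [posterior, bayes]
    rw [hp, ih, weight_cons]
    field_simp

theorem fullSupport_posterior {π₀ : θ.Belief} (hπ₀ : θ.FullSupport π₀) (h : List (A × Y)) :
    θ.FullSupport (θ.posterior π₀ h) := fun ω => by
  rw [posterior_apply]
  exact div_pos (mul_pos (hπ₀ ω) (weight_pos (fun a y => θ.q_pos a ω y) h))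
    (θ.likelihood_pos π₀ h)

end Model

/-- An agent who follows `pol` from period `T` on continues as a dogmatic modeler whose prior is
the posterior of period `T`. -/
theorem history_splice {θ : Model E} {π₀ : θ.Belief} {pol : θ.Belief → A}
    {act : List (A × Y) → A} {T : ℕ} {w z : ℕ → A → Y}
    (h : ∀ s, act (history act (splice T w z) (T + s)) =
      pol (θ.posterior π₀ (history act (splice T w z) (T + s)))) (s : ℕ) :
    history act (splice T w z) (T + s) =
      history (dogmaticAction θ (θ.posterior π₀ (history act w T)) pol) z s ++
        history act w T := by
  induction s with
  | zero =>
    exact history_congr fun t ht => if_pos ht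
  | succ s ih =>
    have h1 : act (history act (splice T w z) (T + s)) =
        dogmaticAction θ (θ.posterior π₀ (history act w T)) pol
          (history (dogmaticAction θ (θ.posterior π₀ (history act w T)) pol) z s) := by
      rw [h s, ih, Model.posterior_append, dogmaticAction]
    have h2 : splice T w z (T + s) = z s := by simp [splice]
    rw [← add_assoc, history, h1, h2, ih]
    rfl

end Splice

/-! ### Measurability of the switcher's play -/

theorem measurable_belief {θ : Model E} {X : Type*} {m : MeasurableSpace X} {f : X → θ.Belief}
    (hf : ∀ ω, Measurable fun x => (f x).1 ω) : Measurable f :=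
  Measurable.subtype_mk (measurable_pi_lambda _ hf)

section Switcher

variable [Fintype A]

theorem measurable_likelihood_history (θ : Model E) (π₀ : θ.Belief) {act : List (A × Y) → A}
    (t : ℕ) (hact : ∀ s < t, ∀ a,
      MeasurableSet[outcomeFiltration A Y s] {y | act (history act y s) = a}) :
    Measurable[outcomeFiltration A Y t] fun y => θ.likelihood π₀ (history act y t) := by
  simp_rw [Model.likelihood_eq]
  exact Finset.measurable_fun_sum Finset.univ fun ω _ =>
    (measurable_weight_history (fun a => θ.q_measurable a ω) t hact).const_mul _

theorem measurable_posterior_history (θ : Model E) (π₀ : θ.Belief) {act : List (A × Y) → A}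
    (t : ℕ) (hact : ∀ s < t, ∀ a,
      MeasurableSet[outcomeFiltration A Y s] {y | act (history act y s) = a}) :
    Measurable[outcomeFiltration A Y t] fun y => θ.posterior π₀ (history act y t) := by
  refine measurable_belief fun ω => ?_
  simp_rw [Model.posterior_apply]
  exact ((measurable_weight_history (fun a => θ.q_measurable a ω) t hact).const_mul _).div
    (measurable_likelihood_history θ π₀ t hact)

theorem measurableSet_modelChoice_history (θ θc : Model E) (α : ℝ) (π₀ : θ.Belief)
    (πc : θc.Belief) {act : List (A × Y) → A} (t : ℕ) (hact : ∀ s < t, ∀ a,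
      MeasurableSet[outcomeFiltration A Y s] {y | act (history act y s) = a}) :
    MeasurableSet[outcomeFiltration A Y t]
      {y | modelChoice θ θc α π₀ πc (history act y t) = .initial} := by
  induction t with
  | zero => simp [history, modelChoice]
  | succ t ih =>
    have ih := (outcomeFiltration A Y).mono t.le_succ _
      (ih fun s hs => hact s (hs.trans t.lt_succ_self))
    have hl := measurable_likelihood_history θ π₀ (t + 1) hact
    have hlc := measurable_likelihood_history θc πc (t + 1) hact
    have hset : {y | modelChoice θ θc α π₀ πc (history act y (t + 1)) = .initial} =
        ({y | modelChoice θ θc α π₀ πc (history act y t) = .initial} ∩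
          {y | α < θc.likelihood πc (history act y (t + 1)) /
            θ.likelihood π₀ (history act y (t + 1))}ᶜ) ∪
        ({y | modelChoice θ θc α π₀ πc (history act y t) = .initial}ᶜ ∩
          {y | α < θ.likelihood π₀ (history act y (t + 1)) /
            θc.likelihood πc (history act y (t + 1))}) := by
      ext y
      simp only [mem_ofPred_eq, mem_union, mem_inter_iff, mem_compl_iff]
      simp only [history, modelChoice]
      cases modelChoice θ θc α π₀ πc (history act y t) <;> simp
    rw [hset]
    have h1 := measurableSet_lt (measurable_const (a := α)) (hlc.div hl)
    have h2 := measurableSet_lt (measurable_const (a := α)) (hl.div hlc)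
    exact (ih.inter h1.compl).union (ih.compl.inter h2)

theorem isAdapted_switcherAction (θ θc : Model E) (α : ℝ) (π₀ : θ.Belief) (πc : θc.Belief)
    {pol : θ.Belief → A} {polc : θc.Belief → A} (hpol : ∀ a, MeasurableSet (pol ⁻¹' {a}))
    (hpolc : ∀ a, MeasurableSet (polc ⁻¹' {a})) :
    IsAdapted (switcherAction θ θc α π₀ πc pol polc) := by
  set act := switcherAction θ θc α π₀ πc pol polc
  intro t
  -- The action at `t` depends on the model choice and posteriors at `t`, which involve only actions
  -- at earlier dates.
  induction t using Nat.strong_induction_on with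
  | _ t ih =>
  intro a
  have hset : {y | act (history act y t) = a} =
      ({y | modelChoice θ θc α π₀ πc (history act y t) = .initial} ∩
        (fun y => θ.posterior π₀ (history act y t)) ⁻¹' (pol ⁻¹' {a})) ∪
      ({y | modelChoice θ θc α π₀ πc (history act y t) = .initial}ᶜ ∩
        (fun y => θc.posterior πc (history act y t)) ⁻¹' (polc ⁻¹' {a})) := by
    ext y
    simp only [mem_ofPred_eq, mem_union, mem_inter_iff, mem_compl_iff, mem_preimage,
      mem_singleton_iff]
    conv_lhs => simp only [act, switcherAction]
    cases modelChoice θ θc α π₀ πc (history act y t) <;> simp [act]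
  rw [hset]
  have hm := measurableSet_modelChoice_history θ θc α π₀ πc t ih
  exact (hm.inter (measurable_posterior_history θ π₀ t ih (hpol a))).union
    (hm.compl.inter (measurable_posterior_history θc πc t ih (hpolc a)))

end Switcher

/-! ### Building models; likelihood ratios, limit posteriors and equilibria -/

/-- Any finite family of admissible densities, with any positive prior weights, is realized by a
model. -/
theorem exists_model_of_densities {ι : Type*} [Fintype ι] [Nonempty ι] (f : A → ι → Y → ℝ)
    (hm : ∀ a i, Measurable (f a i)) (hpos : ∀ a i y, 0 < f a i y)
    (h1 : ∀ a i, ∫⁻ y, ENNReal.ofReal (f a i y) ∂E.ν = 1)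
    (hu : ∀ a i, Integrable (E.u a) (E.ν.withDensity fun y => ENNReal.ofReal (f a i y)))
    (hlog : ∀ a i, ∃ g : Y → ℝ, MemLp g 2 E.ν ∧
      ∀ᵐ y ∂(E.QStar a), |Real.log (E.qStar a y / f a i y)| ≤ g y)
    (p : ι → ℝ) (hp : ∀ i, 0 < p i) (hsum : ∑ i, p i = 1) :
    ∃ (θ : Model E) (π : θ.Belief), θ.FullSupport π ∧
      ∀ h, θ.likelihood π h = ∑ i, p i * weight (fun a y => f a i y) h := by
  let emb : ι ↪ EuclideanSpace ℝ (Fin 1) :=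
    ⟨fun i => EuclideanSpace.single 0 ((Fintype.equivFin ι i : ℕ) : ℝ), fun i j hij => by
      have h := congrArg (fun v : EuclideanSpace ℝ (Fin 1) => v 0) hij
      simpa [Fin.val_inj] using h⟩
  let e : (Finset.univ.map emb : Finset _) ≃ ι :=
    (Equiv.ofBijective
      (fun i => ⟨emb i, Finset.mem_map_of_mem emb (Finset.mem_univ i)⟩)
      ⟨fun i j hij => emb.injective (congrArg Subtype.val hij), fun ⟨x, hx⟩ => by
        obtain ⟨i, -, hi⟩ := Finset.mem_map.1 hx
        exact ⟨i, Subtype.ext hi⟩⟩).symm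
  let θ : Model E :=
    { dim := 1
      params := Finset.univ.map emb
      params_nonempty := Finset.univ_nonempty.map
      q := fun a ω => f a (e ω)
      q_measurable := fun a ω => hm a _
      q_pos := fun a ω => hpos a _
      q_lintegral := fun a ω => h1 a _
      u_integrable := fun a ω => hu a _
      log_ratio_bound := fun a ω => hlog a _ }
  refine ⟨θ, ⟨fun ω => p (e ω), fun ω => (hp _).le, ?_⟩, fun ω => hp _, fun h => ?_⟩
  · exact (e.sum_comp p).trans hsum
  · exact e.sum_comp fun i => p i * weight (fun a y => f a i y) h

namespace Model

variable (θ : Model E)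

/-- Likelihood ratio of a parameter relative to the true density. -/
def ratio (ω : θ.params) (a : A) (y : Y) : ℝ := θ.q a ω y / E.qStar a y

theorem measurable_ratio (ω : θ.params) (a : A) : Measurable (θ.ratio ω a) :=
  (θ.q_measurable a ω).div (E.qStar_measurable a)

theorem ratio_pos (ω : θ.params) (a : A) (y : Y) : 0 < θ.ratio ω a y :=
  div_pos (θ.q_pos a ω y) (E.qStar_pos a y)

theorem ratio_mul_qStar (ω : θ.params) (a : A) (y : Y) :
    θ.ratio ω a y * E.qStar a y = θ.q a ω y :=
  div_mul_cancel₀ _ (E.qStar_pos a y).ne'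

theorem integrable_ratio (ω : θ.params) (a : A) : Integrable (θ.ratio ω a) (E.QStar a) := by
  rw [Environment.QStar, integrable_withDensity_ofReal_iff (E.qStar_measurable a)
    fun y => (E.qStar_pos a y).le]
  simp_rw [ratio_mul_qStar]
  exact θ.integrable_q a ω

theorem integral_ratio (ω : θ.params) (a : A) : ∫ y, θ.ratio ω a y ∂(E.QStar a) = 1 := by
  rw [Environment.QStar, integral_withDensity_ofReal (E.qStar_measurable a)
    fun y => (E.qStar_pos a y).le]
  simp_rw [ratio_mul_qStar]
  exact θ.integral_q a ω

theorem qStar_ae_eq_of_ratio_ae_eq_one {ω : θ.params} {a : A}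
    (h : θ.ratio ω a =ᵐ[E.QStar a] fun _ => 1) : E.qStar a =ᵐ[E.ν] θ.q a ω := by
  have hac : E.ν ≪ E.QStar a :=
    withDensity_absolutelyContinuous' (E.qStar_measurable a).ennreal_ofReal.aemeasurable
      (ae_of_all _ fun y => by simpa using E.qStar_pos a y)
  filter_upwards [hac.ae_le h] with y hy
  rw [← ratio_mul_qStar, hy, one_mul]

theorem weight_q_eq (ω : θ.params) (h : List (A × Y)) :
    weight (fun a y => θ.q a ω y) h = weight (θ.ratio ω) h * weight E.qStar h := by
  rw [← weight_mul]
  simp_rw [ratio_mul_qStar]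

theorem likelihood_div_weight_qStar (π₀ : θ.Belief) (h : List (A × Y)) :
    θ.likelihood π₀ h / weight E.qStar h = ∑ ω, π₀.1 ω * weight (θ.ratio ω) h := by
  have hW := (weight_pos E.qStar_pos h).ne'
  rw [likelihood_eq, Finset.sum_div]
  refine Finset.sum_congr rfl fun ω _ => ?_
  rw [weight_q_eq]
  field_simp

theorem posterior_apply_eq_ratio (π₀ : θ.Belief) (h : List (A × Y)) (ω : θ.params) :
    (θ.posterior π₀ h).1 ω =
      π₀.1 ω * weight (θ.ratio ω) h / ∑ ω', π₀.1 ω' * weight (θ.ratio ω') h := by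
  have hW := (weight_pos E.qStar_pos h).ne'
  rw [posterior_apply, weight_q_eq, ← likelihood_div_weight_qStar]
  field_simp

/-- If the likelihood ratios converge to limits that do not all vanish, the posterior converges
to the normalized limit. -/
theorem exists_tendsto_posterior {π₀ : θ.Belief} {h : ℕ → List (A × Y)} {L : θ.params → ℝ}
    (hL : ∀ ω, Tendsto (fun t => weight (θ.ratio ω) (h t)) atTop (𝓝 (L ω)))
    (hpos : 0 < ∑ ω, π₀.1 ω * L ω) :
    ∃ π : θ.Belief, (∀ ω, π.1 ω ≠ 0 → L ω ≠ 0) ∧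
      Tendsto (fun t => θ.posterior π₀ (h t)) atTop (𝓝 π) := by
  have hL0 (ω : θ.params) : 0 ≤ L ω :=
    ge_of_tendsto' (hL ω) fun t => (weight_pos (θ.ratio_pos ω) (h t)).le
  refine ⟨⟨fun ω => π₀.1 ω * L ω / ∑ ω', π₀.1 ω' * L ω',
    fun ω => div_nonneg (mul_nonneg (π₀.2.1 ω) (hL0 ω)) hpos.le, ?_⟩, fun ω hω h0 => ?_, ?_⟩
  · rw [← Finset.sum_div, div_self hpos.ne']
  · exact hω (by simp [h0])
  · rw [tendsto_subtype_rng, tendsto_pi_nhds]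
    intro ω
    simp_rw [posterior_apply_eq_ratio]
    exact ((hL ω).const_mul _).div
      (tendsto_finsetSum _ fun ω' _ => (hL ω').const_mul _) hpos.ne'

variable {θ}

/-- Correct prediction on the support makes the weighted divergence zero, its least possible value.
-/
theorem mem_klMinimizers_of_ae_eq [Fintype A] {σ : stdSimplex ℝ A} {ω : θ.params}
    (h : ∀ a, σ.1 a ≠ 0 → E.qStar a =ᵐ[E.ν] θ.q a ω) : ω ∈ θ.klMinimizers σ := by
  intro ω'
  refine le_of_eq_of_le (Finset.sum_eq_zero fun a _ => ?_) zero_le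
  by_cases ha : σ.1 a = 0
  · simp [ha]
  · have : θ.Q a ω = E.QStar a := by
      refine withDensity_congr_ae ?_
      filter_upwards [h a ha] with y hy
      rw [hy]
    rw [this, InformationTheory.klDiv_self, mul_zero]

/-- A path on which every action of `S` is played infinitely often, the agent is optimal, and the
parameters with a nonvanishing likelihood ratio are not refuted by `S`, leads to an SCE. -/
theorem isSelfConfirming_of_tendsto [Fintype A] [Nonempty A] {σ : stdSimplex ℝ A} {S : Finset A}
    (hσ : ∀ a, σ.1 a ≠ 0 ↔ a ∈ S) {b : ℕ → θ.Belief} {π : θ.Belief}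
    (hb : Tendsto b atTop (𝓝 π))
    (hopt : ∀ a ∈ S, ∃ᶠ t in atTop, a ∈ θ.optimalActions E.δ (b t))
    (hq : ∀ ω, π.1 ω ≠ 0 → ∀ a ∈ S, E.qStar a =ᵐ[E.ν] θ.q a ω) : θ.IsSelfConfirming σ := by
  refine ⟨π, fun ω hω => mem_klMinimizers_of_ae_eq fun a ha => hq ω hω a ((hσ a).1 ha),
    fun a ha => ?_, fun ω hω a ha => hq ω hω a ((hσ a).1 ha)⟩
  refine mem_myopicActions_of_mem_optimalActions E.δ_nonneg E.δ_lt_one ?_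
    fun ω hω => hq ω hω a ((hσ a).1 ha)
  exact (isClosed_setOf_mem_optimalActions θ E.δ_nonneg E.δ_lt_one a).mem_of_frequently_of_tendsto
    (hopt a ((hσ a).1 ha)) hb

end Model

theorem exists_stdSimplex_support [Fintype A] {S : Finset A} (hS : S.Nonempty) :
    ∃ σ : stdSimplex ℝ A, ∀ a, σ.1 a ≠ 0 ↔ a ∈ S := by
  classical
  have hc : (S.card : ℝ) ≠ 0 := by exact_mod_cast hS.card_pos.ne'
  refine ⟨⟨fun a => if a ∈ S then (S.card : ℝ)⁻¹ else 0, fun a => ?_, ?_⟩, fun a => ?_⟩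
  · dsimp only
    split_ifs <;> positivity
  · simp [hc]
  · by_cases ha : a ∈ S <;> simp [ha, hc]

/-- The actions played infinitely often form a nonempty set, to which play is eventually
confined. -/
theorem exists_finset_frequently [Finite A] (x : ℕ → A) :
    ∃ S : Finset A, S.Nonempty ∧ (∀ a ∈ S, ∃ᶠ t in atTop, x t = a) ∧
      ∀ᶠ t in atTop, x t ∈ S := by
  classical
  have := Fintype.ofFinite A
  let S := Finset.univ.filter fun a => ∃ᶠ t in atTop, x t = a
  have hev : ∀ᶠ t in atTop, x t ∈ S := by
    have : ∀ᶠ t in atTop, ∀ a, a ∉ S → x t ≠ a := eventually_all.2 fun a => by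
      by_cases ha : a ∈ S
      · exact Eventually.of_forall fun t h => absurd ha h
      · have : ¬ ∃ᶠ t in atTop, x t = a := by simpa [S] using ha
        exact (not_frequently.1 this).mono fun t ht _ => ht
    filter_upwards [this] with t ht
    by_contra hcon
    exact ht _ hcon rfl
  obtain ⟨t, ht⟩ := hev.exists
  exact ⟨S, ⟨_, ht⟩, fun a ha => (Finset.mem_filter.1 ha).2, hev⟩

/-- Holding the initial model at two consecutive dates means that the switching test was run against
the competitor and did not trigger. -/
theorem likelihood_le_of_modelChoice {θ θc : Model E} {α : ℝ} {π₀ : θ.Belief} {πc : θc.Belief}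
    {p : A × Y} {h : List (A × Y)}
    (h0 : modelChoice θ θc α π₀ πc h = .initial)
    (h1 : modelChoice θ θc α π₀ πc (p :: h) = .initial) :
    θc.likelihood πc (p :: h) ≤ α * θ.likelihood π₀ (p :: h) := by
  rw [← div_le_iff₀ (θ.likelihood_pos π₀ _)]
  by_contra! hcon
  simp [modelChoice, h0, hcon] at h1

/-! ### Limits on paths where the initial model is eventually held -/

section Persistence

variable [Fintype A]

theorem ae_likelihood_ratio_limits (θ : Model E) {act : List (A × Y) → A} (hact : IsAdapted act) :
    ∀ᵐ y ∂(outcomeLaw E), ∃ L : θ.params → ℝ,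
      (∀ ω, Tendsto (fun t => weight (θ.ratio ω) (history act y t)) atTop (𝓝 (L ω))) ∧
      ∀ ω, L ω ≠ 0 → ∀ a, (∃ᶠ t in atTop, act (history act y t) = a) →
        E.qStar a =ᵐ[E.ν] θ.q a ω := by
  have h1 : ∀ᵐ y ∂(outcomeLaw E), ∀ ω, ∃ c,
      Tendsto (fun t => weight (θ.ratio ω) (history act y t)) atTop (𝓝 c) :=
    ae_all_iff.2 fun ω => ae_exists_tendsto_weight_history (θ.measurable_ratio ω)
      (fun a y => (θ.ratio_pos ω a y).le) (θ.integrable_ratio ω) (θ.integral_ratio ω) hact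
  have h2 : ∀ᵐ y ∂(outcomeLaw E), ∀ ω a, ¬ E.qStar a =ᵐ[E.ν] θ.q a ω →
      (∃ᶠ t in atTop, act (history act y t) = a) →
      Tendsto (fun t => weight (θ.ratio ω) (history act y t)) atTop (𝓝 0) := by
    refine ae_all_iff.2 fun ω => ae_all_iff.2 fun a => ?_
    by_cases hq : E.qStar a =ᵐ[E.ν] θ.q a ω
    · exact ae_of_all _ fun y h => absurd hq h
    · filter_upwards [ae_tendsto_weight_zero_of_frequently (θ.measurable_ratio ω) (θ.ratio_pos ω)
        (θ.integrable_ratio ω) (θ.integral_ratio ω) hact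
        (fun h => hq (θ.qStar_ae_eq_of_ratio_ae_eq_one h))] with y hy _ using hy
  filter_upwards [h1, h2] with y hy1 hy2
  choose L hL using hy1
  refine ⟨L, hL, fun ω hω a ha => ?_⟩
  by_contra hq
  exact hω (tendsto_nhds_unique (hL ω) (hy2 ω a hq ha))

variable {θ θc : Model E} {α : ℝ} {π₀ : θ.Belief} {πc : θc.Belief} {pol : θ.Belief → A}
  {polc : θc.Belief → A}

variable (θ θc α π₀ πc pol polc) in
/-- Paths on which the switcher, from period `T` on, holds the initial model and plays only
actions in `S`. -/
def settledPaths (T : ℕ) (S : Finset A) : Set (ℕ → A → Y) :=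
  {y | ∀ t, T ≤ t →
    modelChoice θ θc α π₀ πc (history (switcherAction θ θc α π₀ πc pol polc) y t) = .initial ∧
      switcherAction θ θc α π₀ πc pol polc
        (history (switcherAction θ θc α π₀ πc pol polc) y t) ∈ S}

theorem measurableSet_settledPaths (hpol : ∀ a, MeasurableSet (pol ⁻¹' {a}))
    (hpolc : ∀ a, MeasurableSet (polc ⁻¹' {a})) (T : ℕ) (S : Finset A) :
    MeasurableSet (settledPaths θ θc α π₀ πc pol polc T S) := by
  have hact := isAdapted_switcherAction θ θc α π₀ πc hpol hpolc
  have heq : settledPaths θ θc α π₀ πc pol polc T S = ⋂ t, ⋂ _ : T ≤ t,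
      {y | modelChoice θ θc α π₀ πc
        (history (switcherAction θ θc α π₀ πc pol polc) y t) = .initial} ∩
      ⋃ a ∈ S, {y | switcherAction θ θc α π₀ πc pol polc
        (history (switcherAction θ θc α π₀ πc pol polc) y t) = a} := by
    ext y
    simp [settledPaths]
  rw [heq]
  refine MeasurableSet.iInter fun t => MeasurableSet.iInter fun _ => MeasurableSet.inter ?_ ?_
  · exact (outcomeFiltration A Y).le t _
      (measurableSet_modelChoice_history θ θc α π₀ πc t fun s _ => hact s)
  · exact Finset.measurableSet_biUnion _ fun a _ => (outcomeFiltration A Y).le t _ (hact t a)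

/-- If the switcher settles on the initial model and on actions in `S` with positive probability,
then so does the dogmatic modeler, at a prior equal to one of the switcher's posteriors. -/
theorem exists_dogmatic_of_settledPaths (hπ₀ : θ.FullSupport π₀)
    (hpol : ∀ a, MeasurableSet (pol ⁻¹' {a})) (hpolc : ∀ a, MeasurableSet (polc ⁻¹' {a}))
    {T : ℕ} {S : Finset A}
    (h : outcomeLaw E (settledPaths θ θc α π₀ πc pol polc T S) ≠ 0) :
    ∃ π₁ : θ.Belief, θ.FullSupport π₁ ∧ 0 < outcomeLaw E {z | ∀ t,
      dogmaticAction θ π₁ pol (history (dogmaticAction θ π₁ pol) z t) ∈ S} := by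
  set act := switcherAction θ θc α π₀ πc pol polc
  have hG := measurableSet_settledPaths (θ := θ) (θc := θc) (α := α) (π₀ := π₀) (πc := πc)
    hpol hpolc T S
  -- By Fubini, some fixed initial path `w` leaves a set of continuations `z` of positive
  -- probability.
  rw [← (measurePreserving_splice E T).measure_preimage hG.nullMeasurableSet, Ne,
    Measure.measure_prod_null (measurable_splice T hG)] at h
  obtain ⟨w, hw⟩ := (not_eventually.1 h).exists
  refine ⟨θ.posterior π₀ (history act w T), θ.fullSupport_posterior hπ₀ _,
    (pos_iff_ne_zero.2 hw).trans_le (measure_mono fun z hz t => ?_)⟩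
  have hz : ∀ t, T ≤ t →
      modelChoice θ θc α π₀ πc (history act (splice T w z) t) = .initial ∧
        act (history act (splice T w z) t) ∈ S := hz
  have hplay (s : ℕ) : act (history act (splice T w z) (T + s)) =
      pol (θ.posterior π₀ (history act (splice T w z) (T + s))) := by
    have := (hz (T + s) (Nat.le_add_right _ _)).1
    simp only [act] at this ⊢
    rw [switcherAction, this]
  have h1 := (hz (T + t) (Nat.le_add_right _ _)).2
  rwa [hplay t, history_splice hplay t, Model.posterior_append] at h1

theorem isPAbsorbing_of_settledPaths (hπ₀ : θ.FullSupport π₀) (hpol : θ.IsOptimalPolicy pol)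
    (hpolc : ∀ a, MeasurableSet (polc ⁻¹' {a})) {T : ℕ} {S : Finset A}
    (h : outcomeLaw E (settledPaths θ θc α π₀ πc pol polc T S) ≠ 0) {σ : stdSimplex ℝ A}
    (hσ : ∀ a, σ.1 a ≠ 0 ↔ a ∈ S) (hsc : θ.IsSelfConfirming σ) : θ.IsPAbsorbing σ := by
  obtain ⟨π, h1, h2, -⟩ := hsc
  refine ⟨⟨π, h1, h2⟩, ?_⟩
  obtain ⟨π₁, hπ₁, hpos⟩ := exists_dogmatic_of_settledPaths hπ₀ hpol.measurable hpolc h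
  -- The waiting time is zero because the settling period is already absorbed in the prior `π₁`.
  refine ⟨π₁, hπ₁, pol, hpol, 0, ?_⟩
  simpa [hσ] using hpos

/-- On almost every path on which the switcher eventually holds the initial model, the limit
likelihood ratios are supported on the parameters that some p-absorbing SCE justifies. -/
theorem ae_limit_support_of_persistence [Nonempty A] (hπ₀ : θ.FullSupport π₀)
    (hpol : θ.IsOptimalPolicy pol) (hpolc : ∀ a, MeasurableSet (polc ⁻¹' {a})) :
    ∀ᵐ y ∂(outcomeLaw E),
      (∀ᶠ t in atTop, modelChoice θ θc α π₀ πc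
        (history (switcherAction θ θc α π₀ πc pol polc) y t) = .initial) →
      ∃ L : θ.params → ℝ,
        (∀ ω, Tendsto (fun t => weight (θ.ratio ω)
          (history (switcherAction θ θc α π₀ πc pol polc) y t)) atTop (𝓝 (L ω))) ∧
        (0 < ∑ ω, π₀.1 ω * L ω →
          ∀ ω, L ω ≠ 0 → ω ∈ ⋃ σ ∈ θ.pAbsorbingSCE, θ.klMinimizers σ) := by
  set act := switcherAction θ θc α π₀ πc pol polc
  have hact : IsAdapted act := isAdapted_switcherAction θ θc α π₀ πc hpol.measurable hpolc
  -- Discard the null settling events, countably many in all; any surviving path then certifies that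
  -- its own settling event has positive probability.
  have hcharge : ∀ᵐ y ∂(outcomeLaw E), ∀ T S, y ∈ settledPaths θ θc α π₀ πc pol polc T S →
      outcomeLaw E (settledPaths θ θc α π₀ πc pol polc T S) ≠ 0 := by
    refine ae_all_iff.2 fun T => ae_all_iff.2 fun S => ?_
    by_cases h0 : outcomeLaw E (settledPaths θ θc α π₀ πc pol polc T S) = 0
    · filter_upwards [measure_eq_zero_iff_ae_notMem.1 h0] with y hy hy' using absurd hy' hy
    · exact ae_of_all _ fun y _ => h0
  filter_upwards [ae_likelihood_ratio_limits θ hact, hcharge] with y ⟨L, hL, hLq⟩ hch hev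
  refine ⟨L, hL, fun hΛ ω hω => ?_⟩
  obtain ⟨S, hSne, hSfreq, hSev⟩ := exists_finset_frequently fun t => act (history act y t)
  obtain ⟨T, hT⟩ := eventually_atTop.1 (hev.and hSev)
  have hG : outcomeLaw E (settledPaths θ θc α π₀ πc pol polc T S) ≠ 0 := hch T S hT
  obtain ⟨σ, hσ⟩ := exists_stdSimplex_support hSne
  obtain ⟨π, hπ, hlim⟩ := θ.exists_tendsto_posterior hL hΛ
  have hsc : θ.IsSelfConfirming σ := by
    refine Model.isSelfConfirming_of_tendsto hσ hlim (fun a ha => ?_)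
      fun ω hω a ha => hLq ω (hπ ω hω) a (hSfreq a ha)
    refine ((hSfreq a ha).and_eventually hev).mono fun t ⟨ht, hm⟩ => ?_
    rw [← ht]
    simp only [act] at hm ⊢
    rw [switcherAction, hm]
    exact hpol.optimal _
  exact mem_biUnion (show σ ∈ θ.pAbsorbingSCE from
    ⟨hsc, isPAbsorbing_of_settledPaths hπ₀ hpol hpolc hG hσ hsc⟩)
    (Model.mem_klMinimizers_of_ae_eq fun a ha => hLq ω hω a (hSfreq a ((hσ a).1 ha)))

end Persistence

/-! ### The reweighted competitor and the contradiction -/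

/-- A competitor that reweights the prior by a factor above `α` on a set of prior probability less
than `1 / α`, and puts some weight on the truth and on every other parameter. -/
theorem exists_reweighted_competitor (θ : Model E) (π₀ : θ.Belief) {α : ℝ} (hα : 0 < α)
    {C : Set θ.params} (hC : θ.mass π₀ C < 1 / α) :
    ∃ (θc : Model E) (πc : θc.Belief) (κ η : ℝ), θc.FullSupport πc ∧ α < κ ∧ 0 < η ∧
      ∀ h, κ * (∑ ω, C.indicator π₀.1 ω * weight (θ.ratio ω) h) + η ≤
        θc.likelihood πc h / weight E.qStar h := by
  set m := θ.mass π₀ C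
  have hind0 (ω : θ.params) : 0 ≤ C.indicator π₀.1 ω := indicator_nonneg (fun ω _ => π₀.2.1 ω) ω
  have hm0 : 0 ≤ m := Finset.sum_nonneg fun ω _ => hind0 ω
  have hm1 : m ≤ 1 := by
    rw [← π₀.2.2]
    exact Finset.sum_le_sum fun ω _ => indicator_le_self' (fun ω _ => π₀.2.1 ω) ω
  have hαm : m * α < 1 := (lt_div_iff₀ hα).1 hC
  -- Since `m ≤ 1`, the product `κ * m` exceeds `α * m` by at most half the slack `1 - m * α`, so it
  -- stays below one.
  set κ := α + (1 - m * α) / 2 with hκ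
  have hκα : α < κ := by linarith
  have hκm : κ * m < 1 := by nlinarith
  set K : ℝ := Fintype.card θ.params + 1
  have hK : 0 < K := by positivity
  -- The mass left over is shared equally among the `K` points: all parameters of `θ` and the truth.
  set η := (1 - κ * m) / K
  have hη : 0 < η := div_pos (by linarith) hK
  have hκ0 : 0 < κ := hα.trans hκα
  let f : A → Option θ.params → Y → ℝ := fun a i => i.elim (E.qStar a) (θ.q a)
  let p : Option θ.params → ℝ := fun i => i.elim η fun ω => κ * C.indicator π₀.1 ω + η
  obtain ⟨θc, πc, hfull, hlik⟩ := exists_model_of_densities (E := E) f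
    (fun a i => by
      cases i
      exacts [E.qStar_measurable a, θ.q_measurable a _])
    (fun a i => by
      cases i
      exacts [E.qStar_pos a, θ.q_pos a _])
    (fun a i => by
      cases i
      exacts [E.qStar_lintegral a, θ.q_lintegral a _])
    (fun a i => by
      cases i
      exacts [E.u_integrable a, θ.u_integrable a _])
    (fun a i => by
      cases i
      · refine ⟨0, MemLp.zero, ae_of_all _ fun y => ?_⟩
        simp [f, div_self (E.qStar_pos a y).ne']
      · exact θ.log_ratio_bound a _)
    p
    (fun i => by
      cases i
      · exact hη
      · exact add_pos_of_nonneg_of_pos (mul_nonneg hκ0.le (hind0 _)) hη)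
    (by
      rw [Fintype.sum_option]
      simp only [p, Option.elim, Finset.sum_add_distrib, ← Finset.mul_sum, Finset.sum_const,
        Finset.card_univ, nsmul_eq_mul]
      have hmdef : ∑ ω, C.indicator π₀.1 ω = m := rfl
      have hηK : η * K = 1 - κ * m := div_mul_cancel₀ _ hK.ne'
      rw [hmdef]
      simp only [K] at hηK
      linarith)
  refine ⟨θc, πc, κ, η, hfull, hκα, hη, fun h => ?_⟩
  have hW := weight_pos E.qStar_pos h
  rw [hlik, Fintype.sum_option, add_div, add_comm, Finset.sum_div, Finset.mul_sum]
  refine add_le_add ?_ (Finset.sum_le_sum fun ω _ => ?_)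
  · change η ≤ η * weight E.qStar h / weight E.qStar h
    rw [mul_div_cancel_right₀ _ hW.ne']
  · change _ ≤ (κ * C.indicator π₀.1 ω + η) * weight (fun a y => θ.q a ω y) h / weight E.qStar h
    rw [Model.weight_q_eq, mul_div_assoc, mul_div_cancel_right₀ _ hW.ne', ← mul_assoc]
    exact mul_le_mul_of_nonneg_right (by linarith) (weight_pos (θ.ratio_pos ω) h).le

theorem one_div_le_mass_of_persistsAgainst [Fintype A] [Nonempty A] {α : ℝ} (hα : 1 < α)
    (θ : Model E) (π₀ : θ.Belief) (hπ₀ : θ.FullSupport π₀) (pol : θ.Belief → A)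
    (hpol : θ.IsOptimalPolicy pol)
    (hpersist : ∀ (θc : Model E) (πc : θc.Belief), θc.FullSupport πc →
      ∀ polc : θc.Belief → A, θc.IsOptimalPolicy polc →
        PersistsAgainst θ θc α π₀ πc pol polc) :
    1 / α ≤ θ.mass π₀ (⋃ σ ∈ θ.pAbsorbingSCE, θ.klMinimizers σ) := by
  have hα0 : 0 < α := zero_lt_one.trans hα
  by_contra! hC
  set C := ⋃ σ ∈ θ.pAbsorbingSCE, θ.klMinimizers σ
  obtain ⟨θc, πc, κ, η, hfull, hκ, hη, hlik⟩ := exists_reweighted_competitor θ π₀ hα0 hC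
  obtain ⟨polc, hpolc⟩ := Model.exists_isOptimalPolicy θc
  have hP := hpersist θc πc hfull polc hpolc
  have hae := ae_limit_support_of_persistence (α := α) (πc := πc) hπ₀ hpol hpolc.measurable
  unfold PersistsAgainst at hP
  set act := switcherAction θ θc α π₀ πc pol polc
  -- A single path suffices: the persistence event has positive probability, so it meets the almost
  -- sure event.
  obtain ⟨y, ⟨T, hT⟩, hy⟩ := nonempty_of_measure_ne_zero
    (ne_of_gt (hP.trans_eq (measure_inter_conull (mem_ae_iff.1 hae)).symm))
  obtain ⟨L, hL, hsupp⟩ := hy (eventually_atTop.2 ⟨T, hT⟩)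
  have hL0 (ω : θ.params) : 0 ≤ L ω :=
    ge_of_tendsto' (hL ω) fun t => (weight_pos (θ.ratio_pos ω) _).le
  have hineq : κ * (∑ ω, C.indicator π₀.1 ω * L ω) + η ≤ α * ∑ ω, π₀.1 ω * L ω := by
    refine le_of_tendsto_of_tendsto
      (((tendsto_finsetSum _ fun ω _ => (hL ω).const_mul _).const_mul κ).add_const η)
      ((tendsto_finsetSum _ fun ω _ => (hL ω).const_mul _).const_mul α) ?_
    -- The likelihood bound at `t` also needs the label at `t - 1`, hence the start at `T + 1`.
    filter_upwards [eventually_ge_atTop (T + 1)] with t ht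
    obtain ⟨s, rfl⟩ := Nat.exists_eq_add_of_lt ht
    have hle := likelihood_le_of_modelChoice (hT (T + s) (by omega)) (hT (T + s + 1) (by omega))
    have hW := weight_pos E.qStar_pos (history act y (T + s + 1))
    rw [← Model.likelihood_div_weight_qStar, ← mul_div_assoc]
    exact (hlik _).trans (div_le_div_of_nonneg_right hle hW.le)
  -- The weight on the truth bounds the left side of `hineq` below by `η > 0`, which rules out that
  -- all likelihood ratios vanish.
  have hΛ : 0 < ∑ ω, π₀.1 ω * L ω := by
    have h1 : 0 ≤ ∑ ω, C.indicator π₀.1 ω * L ω := Finset.sum_nonneg fun ω _ =>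
      mul_nonneg (indicator_nonneg (fun ω _ => π₀.2.1 ω) ω) (hL0 ω)
    have h2 := mul_nonneg (hα0.trans hκ).le h1
    exact pos_of_mul_pos_right (by linarith) hα0.le
  have hind : ∑ ω, C.indicator π₀.1 ω * L ω = ∑ ω, π₀.1 ω * L ω := by
    refine Finset.sum_congr rfl fun ω _ => ?_
    by_cases hω : L ω = 0
    · simp [hω]
    · rw [indicator_of_mem (hsupp hΛ ω hω)]
  rw [hind] at hineq
  nlinarith

end SwitcherModel

end

theorem theorem2 {A : Type*} [Fintype A] [Nonempty A]
    {n : ℕ} (Y : Set (EuclideanSpace ℝ (Fin n))) (hY : Y = Set.univ ∨ IsCompact Y)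
    (E : SwitcherModel.Environment A Y) (α : ℝ) (hα : 1 < α)
    (θ : SwitcherModel.Model E) (π₀ : θ.Belief) (hπ₀ : θ.FullSupport π₀)
    (pol : θ.Belief → A) (hpol : θ.IsOptimalPolicy pol)
    (hpersist : ∀ (θc : SwitcherModel.Model E) (πc : θc.Belief), θc.FullSupport πc →
      ∀ polc : θc.Belief → A, θc.IsOptimalPolicy polc →
        SwitcherModel.PersistsAgainst θ θc α π₀ πc pol polc) :
    1 / α ≤ θ.mass π₀ (⋃ σ ∈ θ.pAbsorbingSCE, θ.klMinimizers σ) := by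
  exact SwitcherModel.one_div_le_mass_of_persistsAgainst hα θ π₀ hπ₀ pol hpol hpersist
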